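/- Let $\pi:E\to M$ be a smooth fibre bundle with $\dim M=n$ and $\dim E=n+k$. **Notation.** Indices $i,j$ run from $1$ to $n$, indices $A,B$ from $1$ to $k$, and repeated indices are summed. * $J^1\pi$ is the first jet bundle; its points over $e\in E$ are the linear maps $\tau:T_{\pi(e)}M\to T_eE$ with $\pi_*(e)\circ\tau=\mathrm{id}$ (for the jet of a local section $\phi$ at $x$: $\tau=\phi_*(x)$, $e=\phi(x)$), and $\pi_{1,0}:J^1\pi\to E$ is the projection. The contact form is $\omega^1(\tau)(X)=v-\tau(\pi_*v)\in V_e\pi=\ker\pi_*(e)$, where $v=(\pi_{1,0})_*X$. For $\eta\in T^*_{\pi(e)}M$ and $\zeta\in V_e\pi$ the vertical lift is $\eta\odot_\tau\zeta=\frac{d}{dt}(\tau+t\,\eta\otimes\zeta)|_{t=0}\in T_\tau J^1\pi$. For a $1$-form $\alpha$ on $M$, the vertical endomorphism is $S_\alpha(\tau)(X)=\alpha_{\pi(e)}\odot_\tau\omega^1(\tau)(X)$, $X\in T_\tau J^1\pi$. * $L_\pi E$ is the adapted frame bundle; its points over $e\in E$ are the bases $u=(e_i,e_A)_e$ of $T_eE$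 with $\pi_*(e)(e_A)=0$, and $\lambda:L_\pi E\to E$ is the projection. The group $G_V$ of invertible matrices $g=\begin{pmatrix}A&0\\C&B\end{pmatrix}$ ($A\in GL(n)$, $B\in GL(k)$) acts on the right by $(e_i,e_A)\cdot g=(A^j_ie_j+C^B_ie_B,\;B^B_Ae_B)$. $\theta^B$ are the components of the soldering form: $\theta^B(u)(Y)$ is the coefficient of $e_B$ in $\lambda_*Y$ with respect to $u$. $E^{*i}_B(u)=\frac{d}{dt}(u\cdot\exp(tE^i_B))|_{t=0}$, where $E^i_B$ is the matrix whose only nonzero entry is a $1$ in the row of $B$ and the column of $i$ (so in the block $C$). * $\rho:L_\pi E\to J^1\pi$ takes $(e_i,e_A)_e$ to the linear map $\pi_*(e)(e_i)\mapsto e_i$. * With $H=GL(n)\times GL(k)$, identify $G_V/H$ with the $k\times n$ matrices $\xi=(\xi^A_i)$, on which $G_V$ acts by $g\cdot\xi=CA^{-1}+B\xi A^{-1}$. A class $[u,\xi]\in L_\pi E\times_{G_V}(G_V/H)$, where $[u\cdot g,\xi]=[u,g\cdot\xi]$, is identified with the jet $\pi_*(e)(e_i)\mapsto e_i+\xi^A_ie_A$.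 Put $u\cdot\xi=(e_i+\xi^A_ie_A,\;e_A)_e\in L_\pi E$. **Proposition.** Let $\alpha$ be any $1$-form on $M$, $u=(e_i,e_A)_e\in L_\pi E$ and $\xi$ a real $k\times n$ matrix. 1. $\rho(u\cdot\xi)=[u,\xi]$, and for all $X\in T_{[u,\xi]}J^1\pi$ and $\tilde X\in T_{u\cdot\xi}L_\pi E$ that project onto the same vector on $E$, i.e. $(\pi_{1,0})_*X=\lambda_*\tilde X$, $$S_\alpha([u,\xi])(X)=\rho_*(u\cdot\xi)\Big((\pi^*\alpha)_e(e_i)\,\big(E^{*i}_B\otimes\theta^B\big)(u\cdot\xi)(\tilde X)\Big).$$ 2. The right-hand side does not depend on the representative: if $[u,\xi]=[\bar u,\bar\xi]$ with $\bar u=(\bar e_i,\bar e_A)_e$, and $\tilde X\in T_{u\cdot\xi}L_\pi E$ and $\bar X\in T_{\bar u\cdot\bar\xi}L_\pi E$ project onto the same vector on $E$, then $$\rho_*(u\cdot\xi)\Big((\pi^*\alpha)_e(e_i)\,(E^{*i}_B\otimes\theta^B)(u\cdot\xi)(\tilde X)\Big)=\rho_*(\bar u\cdot\bar\xi)\Big((\pi^*\alpha)_e(\bar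 e_i)\,(E^{*i}_B\otimes\theta^B)(\bar u\cdot\bar\xi)(\bar X)\Big).$$ -/

import Mathlib

open Set Function
open scoped Manifold ContDiff Topology

/-! ### Fibre bundles and adapted coordinates -/

section Bundles

/-- The tangent space at `x` of a manifold of dimension `d`. -/
abbrev TSp (d : ℕ) {N : Type*} [TopologicalSpace N] [ChartedSpace (EuclideanSpace ℝ (Fin d)) N]
    (x : N) : Type :=
  TangentSpace 𝓘(ℝ, EuclideanSpace ℝ (Fin d)) x

/-- A smooth fibre bundle `π : E → M` with typical fibre `F`, where `dim M = n`, `dim F = k` and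
`dim E = n + k`. -/
structure SmoothFiberBundle (n k : ℕ) (F E M : Type*)
    [TopologicalSpace F] [ChartedSpace (EuclideanSpace ℝ (Fin k)) F]
    [TopologicalSpace E] [ChartedSpace (EuclideanSpace ℝ (Fin (n + k))) E]
    [TopologicalSpace M] [ChartedSpace (EuclideanSpace ℝ (Fin n)) M] where
  /-- the projection `π` -/
  proj : E → M
  contMDiff_proj : ContMDiff 𝓘(ℝ, EuclideanSpace ℝ (Fin (n + k)))
    𝓘(ℝ, EuclideanSpace ℝ (Fin n)) ∞ proj
  /-- around each point of `M` there is a local trivialization that is a diffeomorphism -/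
  locallyTrivial : ∀ x : M, ∃ t : Bundle.Trivialization F proj, x ∈ t.baseSet ∧
    ContMDiffOn 𝓘(ℝ, EuclideanSpace ℝ (Fin (n + k)))
      (𝓘(ℝ, EuclideanSpace ℝ (Fin n)).prod 𝓘(ℝ, EuclideanSpace ℝ (Fin k))) ∞
      t.toOpenPartialHomeomorph t.source ∧
    ContMDiffOn (𝓘(ℝ, EuclideanSpace ℝ (Fin n)).prod 𝓘(ℝ, EuclideanSpace ℝ (Fin k)))
      𝓘(ℝ, EuclideanSpace ℝ (Fin (n + k))) ∞
      t.toOpenPartialHomeomorph.symm t.target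

variable {n k : ℕ} {F E M : Type*}
  [TopologicalSpace F] [ChartedSpace (EuclideanSpace ℝ (Fin k)) F]
  [TopologicalSpace E] [ChartedSpace (EuclideanSpace ℝ (Fin (n + k))) E]
  [TopologicalSpace M] [ChartedSpace (EuclideanSpace ℝ (Fin n)) M]

namespace SmoothFiberBundle

/-- The tangent map `π_*(e) : T_e E → T_{π(e)} M`. -/
noncomputable def dproj (P : SmoothFiberBundle n k F E M) (e : E) :
    TSp (n + k) e →L[ℝ] TSp n (P.proj e) :=
  mfderiv 𝓘(ℝ, EuclideanSpace ℝ (Fin (n + k))) 𝓘(ℝ, EuclideanSpace ℝ (Fin n)) P.proj e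

/-- Adapted coordinates `(x^i, y^A)` on an open set of `E`, over coordinates `(x^i)` on an open set
of `M`. -/
structure AdaptedChart (P : SmoothFiberBundle n k F E M) where
  φ : OpenPartialHomeomorph E (EuclideanSpace ℝ (Fin n) × EuclideanSpace ℝ (Fin k))
  ψ : OpenPartialHomeomorph M (EuclideanSpace ℝ (Fin n))
  contMDiffOn_φ : ContMDiffOn 𝓘(ℝ, EuclideanSpace ℝ (Fin (n + k)))
    𝓘(ℝ, EuclideanSpace ℝ (Fin n) × EuclideanSpace ℝ (Fin k)) ∞ φ φ.source
  contMDiffOn_φ_symm : ContMDiffOn 𝓘(ℝ, EuclideanSpace ℝ (Fin n) × EuclideanSpace ℝ (Fin k))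
    𝓘(ℝ, EuclideanSpace ℝ (Fin (n + k))) ∞ φ.symm φ.target
  contMDiffOn_ψ : ContMDiffOn 𝓘(ℝ, EuclideanSpace ℝ (Fin n))
    𝓘(ℝ, EuclideanSpace ℝ (Fin n)) ∞ ψ ψ.source
  contMDiffOn_ψ_symm : ContMDiffOn 𝓘(ℝ, EuclideanSpace ℝ (Fin n))
    𝓘(ℝ, EuclideanSpace ℝ (Fin n)) ∞ ψ.symm ψ.target
  proj_mem : ∀ e ∈ φ.source, P.proj e ∈ ψ.source
  fst_eq : ∀ e ∈ φ.source, (φ e).1 = ψ (P.proj e)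

theorem exists_adaptedChart (P : SmoothFiberBundle n k F E M)
    [IsManifold 𝓘(ℝ, EuclideanSpace ℝ (Fin k)) ∞ F] [IsManifold 𝓘(ℝ, EuclideanSpace ℝ (Fin n)) ∞ M]
    (e : E) : ∃ c : P.AdaptedChart, e ∈ c.φ.source := by
  obtain ⟨t, hx, ht, ht'⟩ := P.locallyTrivial (P.proj e)
  set a := chartAt (EuclideanSpace ℝ (Fin n)) (P.proj e)
  set f : F := (t e).2
  set b := chartAt (EuclideanSpace ℝ (Fin k)) f
  have ha : ContMDiffOn 𝓘(ℝ, EuclideanSpace ℝ (Fin n)) 𝓘(ℝ, EuclideanSpace ℝ (Fin n)) ∞ a a.source :=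
    contMDiffOn_chart
  have ha' : ContMDiffOn 𝓘(ℝ, EuclideanSpace ℝ (Fin n)) 𝓘(ℝ, EuclideanSpace ℝ (Fin n)) ∞
    a.symm a.target := contMDiffOn_chart_symm
  have hb : ContMDiffOn 𝓘(ℝ, EuclideanSpace ℝ (Fin k)) 𝓘(ℝ, EuclideanSpace ℝ (Fin k)) ∞ b b.source :=
    contMDiffOn_chart
  have hb' : ContMDiffOn 𝓘(ℝ, EuclideanSpace ℝ (Fin k)) 𝓘(ℝ, EuclideanSpace ℝ (Fin k)) ∞
    b.symm b.target := contMDiffOn_chart_symm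
  have hsrc : ∀ y, y ∈ (t.toOpenPartialHomeomorph.trans (a.prod b)).source →
      y ∈ t.source ∧ P.proj y ∈ a.source ∧ (t y).2 ∈ b.source ∧ (t y).1 = P.proj y := by
    intro y hy
    have h1 : y ∈ t.source := hy.1
    have h2 := hy.2
    have h3 : (t y).1 = P.proj y := t.proj_toFun y h1
    exact ⟨h1, h3 ▸ h2.1, h2.2, h3⟩
  refine ⟨⟨t.toOpenPartialHomeomorph.trans (a.prod b), a, ?_, ?_, ha, ha', ?_, ?_⟩, ?_⟩
  · have h1 : ContMDiffOn 𝓘(ℝ, EuclideanSpace ℝ (Fin (n + k))) 𝓘(ℝ, EuclideanSpace ℝ (Fin n)) ∞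
        (fun y => a (t y).1) (t.toOpenPartialHomeomorph.trans (a.prod b)).source := by
      refine ha.comp (t := a.source) (contMDiff_fst.comp_contMDiffOn (ht.mono fun y hy => (hsrc y hy).1)) ?_
      intro y hy
      exact hy.2.1
    have h2 : ContMDiffOn 𝓘(ℝ, EuclideanSpace ℝ (Fin (n + k))) 𝓘(ℝ, EuclideanSpace ℝ (Fin k)) ∞
        (fun y => b (t y).2) (t.toOpenPartialHomeomorph.trans (a.prod b)).source := by
      refine hb.comp (t := b.source) (contMDiff_snd.comp_contMDiffOn (ht.mono fun y hy => (hsrc y hy).1)) ?_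
      intro y hy
      exact hy.2.2
    exact h1.prodMk_space h2
  · have h0 : (t.toOpenPartialHomeomorph.trans (a.prod b)).target ⊆ (a.prod b).target :=
      fun y hy => hy.1
    have h1 : ContMDiffOn 𝓘(ℝ, EuclideanSpace ℝ (Fin n) × EuclideanSpace ℝ (Fin k))
        (𝓘(ℝ, EuclideanSpace ℝ (Fin n)).prod 𝓘(ℝ, EuclideanSpace ℝ (Fin k))) ∞
        (a.prod b).symm (a.prod b).target := by
      refine ContMDiffOn.prodMk
        (f := fun z : EuclideanSpace ℝ (Fin n) × EuclideanSpace ℝ (Fin k) => a.symm z.1)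
        (g := fun z : EuclideanSpace ℝ (Fin n) × EuclideanSpace ℝ (Fin k) => b.symm z.2) ?_ ?_
      · exact ha'.comp (contDiff_fst.contMDiff.contMDiffOn) fun y hy => hy.1
      · exact hb'.comp (contDiff_snd.contMDiff.contMDiffOn) fun y hy => hy.2
    exact ht'.comp (h1.mono h0) fun y hy => hy.2
  · intro y hy; exact (hsrc y hy).2.1
  · intro y hy
    change a (t y).1 = a (P.proj y)
    rw [(hsrc y hy).2.2.2]
  · have h1 : e ∈ t.source := by rw [t.source_eq]; exact hx
    have h3 : (t e).1 = P.proj e := t.proj_toFun e h1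
    refine ⟨h1, ?_, mem_chart_source _ _⟩
    change (t e).1 ∈ a.source
    rw [h3]; exact mem_chart_source _ _

end SmoothFiberBundle

end Bundles
/-! ### Manifolds from coordinate systems -/

section CoordinateSystems

/-- A smooth atlas on a bare set `X`: injective coordinate maps `coord i`, defined on the sets
`dom i` that cover `X`, with values in a normed space, such that the overlaps have open images and
the changes of coordinates are smooth. -/
structure CoordinateSystem (X : Type*) (H : Type*) [NormedAddCommGroup H] [NormedSpace ℝ H] where
  ι : Type*
  coord : ι → X → H
  dom : ι → Set X
  injOn : ∀ i, InjOn (coord i) (dom i)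
  cover : ∀ x, ∃ i, x ∈ dom i
  isOpen_image : ∀ i j, IsOpen (coord i '' (dom i ∩ dom j))
  smooth : ∀ i j, ∃ T : H → H, ContDiffOn ℝ ∞ T (coord i '' (dom i ∩ dom j)) ∧
    ∀ x ∈ dom i ∩ dom j, T (coord i x) = coord j x

namespace CoordinateSystem

variable {X H : Type*} [NormedAddCommGroup H] [NormedSpace ℝ H]

/-- The chart given by the coordinate map `coord i`, with domain `dom i`; the point `x₀` only
provides a value of the inverse outside of `coord i '' dom i`. -/
noncomputable def chart (C : CoordinateSystem X H) (x₀ : X) (i : C.ι) : PartialEquiv X H :=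
  haveI : Nonempty X := ⟨x₀⟩
  BijOn.toPartialEquiv (C.coord i) (C.dom i) (C.coord i '' C.dom i) (C.injOn i).bijOn_image

theorem chart_trans_source (C : CoordinateSystem X H) (x y : X) (i j : C.ι) :
    ((C.chart x i).symm.trans (C.chart y j)).source = C.coord i '' (C.dom i ∩ C.dom j) := by
  ext z
  constructor
  · rintro ⟨hz, hz'⟩
    exact ⟨(C.chart x i).symm z, ⟨(C.chart x i).map_target hz, hz'⟩, (C.chart x i).right_inv hz⟩
  · rintro ⟨p, ⟨hp, hp'⟩, rfl⟩
    refine ⟨(C.chart x i).map_source hp, ?_⟩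
    have : (C.chart x i).symm (C.coord i p) = p := (C.chart x i).left_inv hp
    change (C.chart x i).symm (C.coord i p) ∈ C.dom j
    rw [this]; exact hp'

theorem contDiffOn_chart_trans (C : CoordinateSystem X H) (x y : X) (i j : C.ι) :
    ContDiffOn ℝ ∞ ((C.chart x i).symm.trans (C.chart y j))
      ((C.chart x i).symm.trans (C.chart y j)).source := by
  rw [chart_trans_source]
  obtain ⟨T, hT, hT'⟩ := C.smooth i j
  refine hT.congr ?_
  rintro _ ⟨p, hp, rfl⟩
  rw [hT' p hp]
  have : (C.chart x i).symm (C.coord i p) = p := (C.chart x i).left_inv hp.1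
  change C.coord j ((C.chart x i).symm (C.coord i p)) = C.coord j p
  rw [this]

/-- The charts `coord i` as an atlas in the sense of Mathlib. -/
noncomputable def core (C : CoordinateSystem X H) : ChartedSpaceCore H X where
  atlas := {e | ∃ x i, e = C.chart x i}
  chartAt x := C.chart x (C.cover x).choose
  mem_chart_source x := (C.cover x).choose_spec
  chart_mem_atlas x := ⟨x, _, rfl⟩
  open_source := by
    rintro _ _ ⟨x, i, rfl⟩ ⟨y, j, rfl⟩
    rw [chart_trans_source]
    exact C.isOpen_image i j
  continuousOn_toFun := by
    rintro _ _ ⟨x, i, rfl⟩ ⟨y, j, rfl⟩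
    exact (C.contDiffOn_chart_trans x y i j).continuousOn

/-- The topology in which the coordinate maps are homeomorphisms onto their images. -/
@[reducible] noncomputable def topology (C : CoordinateSystem X H) : TopologicalSpace X :=
  C.core.toTopologicalSpace

/-- The manifold structure with the coordinate maps as charts. -/
@[reducible] noncomputable def chartedSpace (C : CoordinateSystem X H) :
    @ChartedSpace H _ X C.topology :=
  C.core.toChartedSpace

theorem isManifold (C : CoordinateSystem X H) :
    @IsManifold ℝ _ H _ _ H _ 𝓘(ℝ, H) ∞ X C.topology C.chartedSpace := by
  let _ := C.topology
  let _ := C.chartedSpace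
  refine isManifold_of_contDiffOn 𝓘(ℝ, H) ∞ X ?_
  intro e e' he he'
  obtain ⟨e, he⟩ := mem_iUnion.1 he
  obtain ⟨⟨x, i, rfl⟩, rfl⟩ := mem_iUnion.1 he
  obtain ⟨e', he'⟩ := mem_iUnion.1 he'
  obtain ⟨⟨y, j, rfl⟩, rfl⟩ := mem_iUnion.1 he'
  simp only [modelWithCornersSelf_coe, modelWithCornersSelf_coe_symm, Function.comp_id,
    Function.id_comp, preimage_id, range_id, inter_univ]
  exact C.contDiffOn_chart_trans x y i j

end CoordinateSystem

end CoordinateSystems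
/-! ### The first jet bundle and the adapted frame bundle -/

section Jets

variable {n k : ℕ} {F E M : Type*}
  [TopologicalSpace F] [ChartedSpace (EuclideanSpace ℝ (Fin k)) F]
  [TopologicalSpace E] [ChartedSpace (EuclideanSpace ℝ (Fin (n + k))) E]
  [TopologicalSpace M] [ChartedSpace (EuclideanSpace ℝ (Fin n)) M]

namespace SmoothFiberBundle

namespace AdaptedChart

variable {P : SmoothFiberBundle n k F E M}

theorem mdifferentiable_φ (c : P.AdaptedChart) :
    c.φ.MDifferentiable 𝓘(ℝ, EuclideanSpace ℝ (Fin (n + k)))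
      𝓘(ℝ, EuclideanSpace ℝ (Fin n) × EuclideanSpace ℝ (Fin k)) :=
  ⟨c.contMDiffOn_φ.mdifferentiableOn (by simp), c.contMDiffOn_φ_symm.mdifferentiableOn (by simp)⟩

theorem mdifferentiable_ψ (c : P.AdaptedChart) :
    c.ψ.MDifferentiable 𝓘(ℝ, EuclideanSpace ℝ (Fin n)) 𝓘(ℝ, EuclideanSpace ℝ (Fin n)) :=
  ⟨c.contMDiffOn_ψ.mdifferentiableOn (by simp), c.contMDiffOn_ψ_symm.mdifferentiableOn (by simp)⟩

/-- The components `(dx^i, dy^A)` of tangent vectors of `E` at `e`. -/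
noncomputable def dφ (c : P.AdaptedChart) (e : E) :
    TSp (n + k) e →L[ℝ] EuclideanSpace ℝ (Fin n) × EuclideanSpace ℝ (Fin k) :=
  mfderiv 𝓘(ℝ, EuclideanSpace ℝ (Fin (n + k)))
    𝓘(ℝ, EuclideanSpace ℝ (Fin n) × EuclideanSpace ℝ (Fin k)) c.φ e

/-- The components `(dx^i)` of tangent vectors of `M` at `x`. -/
noncomputable def dψ (c : P.AdaptedChart) (x : M) :
    TSp n x →L[ℝ] EuclideanSpace ℝ (Fin n) :=
  mfderiv 𝓘(ℝ, EuclideanSpace ℝ (Fin n)) 𝓘(ℝ, EuclideanSpace ℝ (Fin n)) c.ψ x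

theorem exists_dφ_equiv (c : P.AdaptedChart) {e : E} (he : e ∈ c.φ.source) :
    ∃ L : TSp (n + k) e ≃L[ℝ] EuclideanSpace ℝ (Fin n) × EuclideanSpace ℝ (Fin k),
      ∀ v, L v = c.dφ e v :=
  ⟨c.mdifferentiable_φ.mfderiv he, fun _ => rfl⟩

theorem exists_dψ_equiv (c : P.AdaptedChart) {x : M} (hx : x ∈ c.ψ.source) :
    ∃ L : TSp n x ≃L[ℝ] EuclideanSpace ℝ (Fin n), ∀ v, L v = c.dψ x v :=
  ⟨c.mdifferentiable_ψ.mfderiv hx, fun _ => rfl⟩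

theorem fst_dφ (c : P.AdaptedChart) {e : E} (he : e ∈ c.φ.source) (v : TSp (n + k) e) :
    (c.dφ e v).1 = c.dψ (P.proj e) (P.dproj e v) := by
  have h1 : HasMFDerivAt 𝓘(ℝ, EuclideanSpace ℝ (Fin (n + k))) 𝓘(ℝ, EuclideanSpace ℝ (Fin n))
      (fun y => (c.φ y).1) e
      ((ContinuousLinearMap.fst ℝ (EuclideanSpace ℝ (Fin n)) (EuclideanSpace ℝ (Fin k))).comp
        (c.dφ e)) :=
    HasMFDerivAt.comp e (I' := 𝓘(ℝ, EuclideanSpace ℝ (Fin n) × EuclideanSpace ℝ (Fin k)))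
      (g := Prod.fst) (hasFDerivAt_fst.hasMFDerivAt)
      (c.mdifferentiable_φ.mdifferentiableAt he).hasMFDerivAt
  have h2 : HasMFDerivAt 𝓘(ℝ, EuclideanSpace ℝ (Fin (n + k))) 𝓘(ℝ, EuclideanSpace ℝ (Fin n))
      (fun y => c.ψ (P.proj y)) e ((c.dψ (P.proj e)).comp (P.dproj e)) :=
    HasMFDerivAt.comp e
      (c.mdifferentiable_ψ.mdifferentiableAt (c.proj_mem e he)).hasMFDerivAt
      ((P.contMDiff_proj.mdifferentiable (by simp)) e).hasMFDerivAt
  have h3 : (fun y => (c.φ y).1) =ᶠ[𝓝 e] fun y => c.ψ (P.proj y) :=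
    Filter.eventually_of_mem (c.φ.open_source.mem_nhds he) c.fst_eq
  exact congrArg (fun L => L v) (hasMFDerivAt_unique h1 (h2.congr_of_eventuallyEq h3))

theorem dφ_change (c c' : P.AdaptedChart) {e : E} (he : e ∈ c.φ.source) (he' : e ∈ c'.φ.source)
    (v : TSp (n + k) e) :
    c'.dφ e v = fderiv ℝ (c'.φ ∘ c.φ.symm) (c.φ e) (c.dφ e v) := by
  have h0 : c.φ.symm (c.φ e) = e := c.φ.left_inv he
  have h1 : MDifferentiableAt 𝓘(ℝ, EuclideanSpace ℝ (Fin n) × EuclideanSpace ℝ (Fin k))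
      𝓘(ℝ, EuclideanSpace ℝ (Fin n) × EuclideanSpace ℝ (Fin k)) (c'.φ ∘ c.φ.symm) (c.φ e) := by
    refine MDifferentiableAt.comp (c.φ e) (I' := 𝓘(ℝ, EuclideanSpace ℝ (Fin (n + k)))) ?_
      (c.mdifferentiable_φ.mdifferentiableAt_symm (c.φ.map_source he))
    rw [h0]
    exact c'.mdifferentiable_φ.mdifferentiableAt he'
  have h2 := HasMFDerivAt.comp e h1.hasMFDerivAt
    (c.mdifferentiable_φ.mdifferentiableAt he).hasMFDerivAt
  have h3 : c'.φ =ᶠ[𝓝 e] (c'.φ ∘ c.φ.symm) ∘ c.φ :=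
    Filter.eventually_of_mem (c.φ.open_source.mem_nhds he) fun y hy => by
      simp [c.φ.left_inv hy]
  have h4 := hasMFDerivAt_unique (c'.mdifferentiable_φ.mdifferentiableAt he').hasMFDerivAt
    (h2.congr_of_eventuallyEq h3)
  rw [mfderiv_eq_fderiv] at h4
  exact congrArg (fun L => L v) h4

theorem dψ_change (c c' : P.AdaptedChart) {x : M} (hx : x ∈ c.ψ.source) (hx' : x ∈ c'.ψ.source)
    (v : TSp n x) :
    c'.dψ x v = fderiv ℝ (c'.ψ ∘ c.ψ.symm) (c.ψ x) (c.dψ x v) := by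
  have h0 : c.ψ.symm (c.ψ x) = x := c.ψ.left_inv hx
  have h1 : MDifferentiableAt 𝓘(ℝ, EuclideanSpace ℝ (Fin n))
      𝓘(ℝ, EuclideanSpace ℝ (Fin n)) (c'.ψ ∘ c.ψ.symm) (c.ψ x) := by
    refine MDifferentiableAt.comp (c.ψ x) (I' := 𝓘(ℝ, EuclideanSpace ℝ (Fin n))) ?_
      (c.mdifferentiable_ψ.mdifferentiableAt_symm (c.ψ.map_source hx))
    rw [h0]
    exact c'.mdifferentiable_ψ.mdifferentiableAt hx'
  have h2 := HasMFDerivAt.comp x h1.hasMFDerivAt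
    (c.mdifferentiable_ψ.mdifferentiableAt hx).hasMFDerivAt
  have h3 : c'.ψ =ᶠ[𝓝 x] (c'.ψ ∘ c.ψ.symm) ∘ c.ψ :=
    Filter.eventually_of_mem (c.ψ.open_source.mem_nhds hx) fun y hy => by
      simp [c.ψ.left_inv hy]
  have h4 := hasMFDerivAt_unique (c'.mdifferentiable_ψ.mdifferentiableAt hx').hasMFDerivAt
    (h2.congr_of_eventuallyEq h3)
  rw [mfderiv_eq_fderiv] at h4
  exact congrArg (fun L => L v) h4

/-- The image under `φ` of the overlap of two adapted coordinate domains. -/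
def overlap (c c' : P.AdaptedChart) : Set (EuclideanSpace ℝ (Fin n) × EuclideanSpace ℝ (Fin k)) :=
  (c.φ.symm.trans c'.φ).source

theorem isOpen_overlap (c c' : P.AdaptedChart) : IsOpen (c.overlap c') :=
  (c.φ.symm.trans c'.φ).open_source

theorem mem_overlap (c c' : P.AdaptedChart) {e : E} (he : e ∈ c.φ.source) (he' : e ∈ c'.φ.source) :
    c.φ e ∈ c.overlap c' := by
  refine ⟨c.φ.map_source he, ?_⟩
  change c.φ.symm (c.φ e) ∈ c'.φ.source
  rw [c.φ.left_inv he]; exact he'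

theorem exists_of_mem_overlap (c c' : P.AdaptedChart)
    {w : EuclideanSpace ℝ (Fin n) × EuclideanSpace ℝ (Fin k)} (hw : w ∈ c.overlap c') :
    ∃ e, e ∈ c.φ.source ∧ e ∈ c'.φ.source ∧ c.φ e = w :=
  ⟨c.φ.symm w, c.φ.map_target hw.1, hw.2, c.φ.right_inv hw.1⟩

theorem contDiffOn_change (c c' : P.AdaptedChart) :
    ContDiffOn ℝ ∞ (c'.φ ∘ c.φ.symm) (c.overlap c') := by
  rw [← contMDiffOn_iff_contDiffOn]
  exact c'.contMDiffOn_φ.comp (c.contMDiffOn_φ_symm.mono fun w hw => hw.1) fun w hw => hw.2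

theorem contDiffOn_change_base (c c' : P.AdaptedChart) :
    ContDiffOn ℝ ∞ (c.ψ ∘ c'.ψ.symm) (c'.ψ.symm.trans c.ψ).source := by
  rw [← contMDiffOn_iff_contDiffOn]
  exact c.contMDiffOn_ψ.comp (c'.contMDiffOn_ψ_symm.mono fun w hw => hw.1) fun w hw => hw.2

theorem fst_change_mem (c c' : P.AdaptedChart)
    {w : EuclideanSpace ℝ (Fin n) × EuclideanSpace ℝ (Fin k)} (hw : w ∈ c.overlap c') :
    ((c'.φ ∘ c.φ.symm) w).1 ∈ (c'.ψ.symm.trans c.ψ).source := by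
  obtain ⟨e, he, he', rfl⟩ := c.exists_of_mem_overlap c' hw
  have h0 : (c'.φ ∘ c.φ.symm) (c.φ e) = c'.φ e := congrArg c'.φ (c.φ.left_inv he)
  rw [h0, c'.fst_eq e he']
  refine ⟨c'.ψ.map_source (c'.proj_mem e he'), ?_⟩
  change c'.ψ.symm (c'.ψ (P.proj e)) ∈ c.ψ.source
  rw [c'.ψ.left_inv (c'.proj_mem e he')]
  exact c.proj_mem e he

end AdaptedChart

theorem dproj_surjective (P : SmoothFiberBundle n k F E M)
    [IsManifold 𝓘(ℝ, EuclideanSpace ℝ (Fin k)) ∞ F] [IsManifold 𝓘(ℝ, EuclideanSpace ℝ (Fin n)) ∞ M]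
    (e : E) : Surjective (P.dproj e) := by
  obtain ⟨c, he⟩ := P.exists_adaptedChart e
  obtain ⟨L, hL⟩ := c.exists_dφ_equiv he
  obtain ⟨L', hL'⟩ := c.exists_dψ_equiv (c.proj_mem e he)
  intro w
  refine ⟨L.symm (L' w, 0), L'.injective ?_⟩
  rw [hL', ← c.fst_dφ he, ← hL]
  simp

/-- The first jet bundle `J¹π`: a point is a linear right inverse `τ : T_{π(e)} M → T_e E` of
`π_*(e)`, for some `e ∈ E`. The jet at `x` of a local section `φ` is `τ = φ_*(x)`, `e = φ(x)`. -/
@[ext] structure Jet1 (P : SmoothFiberBundle n k F E M) where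
  /-- the projection `π_{1,0} : J¹π → E` -/
  pt : E
  τ : TSp n (P.proj pt) →L[ℝ] TSp (n + k) pt
  right_inv : ∀ w, P.dproj pt (τ w) = w

/-- The adapted frame bundle `L_π E`: a point is a basis `(e_i, e_A)` of `T_e E`, for some `e ∈ E`,
with `π_*(e)(e_A) = 0`. -/
@[ext] structure AdaptedFrame (P : SmoothFiberBundle n k F E M) where
  /-- the projection `λ : L_π E → E` -/
  pt : E
  frame : Module.Basis (Fin n ⊕ Fin k) ℝ (TSp (n + k) pt)
  vertical : ∀ A : Fin k, P.dproj pt (frame (Sum.inr A)) = 0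

variable {P : SmoothFiberBundle n k F E M}

/-- The coordinate space of the jet coordinates `(x^i, y^A, y^A_i)`. -/
abbrev JetModel (n k : ℕ) : Type :=
  (EuclideanSpace ℝ (Fin n) × EuclideanSpace ℝ (Fin k)) ×
    (EuclideanSpace ℝ (Fin n) →L[ℝ] EuclideanSpace ℝ (Fin k))

/-- The coordinate space of the frame coordinates `(x^i, y^A, v^i_j, v^A_j, v^A_B)`. -/
abbrev FrameModel (n k : ℕ) : Type :=
  (EuclideanSpace ℝ (Fin n) × EuclideanSpace ℝ (Fin k)) ×
    (Fin n → EuclideanSpace ℝ (Fin n) × EuclideanSpace ℝ (Fin k)) ×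
    (Fin k → EuclideanSpace ℝ (Fin k))

namespace Jet1

/-- The jet coordinates `(x^i, y^A, y^A_i)`; here `(y^A_i)` is the matrix of the linear map
`∂/∂x^i ↦ y^A_i ∂/∂y^A`, the vertical part of `τ`. -/
noncomputable def coord (c : P.AdaptedChart) (j : P.Jet1) :
    JetModel n k :=
  (c.φ j.pt, (ContinuousLinearMap.snd ℝ (EuclideanSpace ℝ (Fin n)) (EuclideanSpace ℝ (Fin k))) ∘L
    (c.dφ j.pt) ∘L j.τ ∘L (c.dψ (P.proj j.pt)).inverse)

theorem dφ_τ (c : P.AdaptedChart) (j : P.Jet1) (hj : j.pt ∈ c.φ.source) (w : TSp n (P.proj j.pt)) :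
    c.dφ j.pt (j.τ w) = (c.dψ _ w, (coord c j).2 (c.dψ _ w)) := by
  obtain ⟨L, hL⟩ := c.exists_dψ_equiv (c.proj_mem _ hj)
  have hL' : c.dψ (P.proj j.pt) = (L : _ →L[ℝ] _) := by ext1 v; exact (hL v).symm
  refine Prod.ext ?_ ?_
  · rw [c.fst_dφ hj, j.right_inv]
  · simp [coord, hL']

/-- The jet over `e` with given coordinates `y^A_i`. -/
theorem exists_coord (c : P.AdaptedChart) {e : E} (he : e ∈ c.φ.source)
    (p : EuclideanSpace ℝ (Fin n) →L[ℝ] EuclideanSpace ℝ (Fin k)) :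
    ∃ j : P.Jet1, j.pt = e ∧ coord c j = (c.φ e, p) := by
  obtain ⟨L, hL⟩ := c.exists_dψ_equiv (c.proj_mem _ he)
  obtain ⟨K, hK⟩ := c.exists_dφ_equiv he
  have hL' : c.dψ (P.proj e) = (L : _ →L[ℝ] _) := by ext1 v; exact (hL v).symm
  have hK' : c.dφ e = (K : _ →L[ℝ] _) := by ext1 v; exact (hK v).symm
  refine ⟨⟨e, (K.symm : _ →L[ℝ] _) ∘L
    ((ContinuousLinearMap.id ℝ (EuclideanSpace ℝ (Fin n))).prod p) ∘L (L : _ →L[ℝ] _), ?_⟩, rfl, ?_⟩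
  · intro w
    apply L.injective
    rw [hL, ← c.fst_dφ he, ← hK]
    simp
  · refine Prod.ext rfl ?_
    ext1 v
    simp [coord, hL', hK']

theorem coord_injOn (c : P.AdaptedChart) : InjOn (coord c) {j : P.Jet1 | j.pt ∈ c.φ.source} := by
  intro j hj j' hj' h
  have hpt : j.pt = j'.pt := c.φ.injOn hj hj' (congrArg Prod.fst h)
  have h2 := congrArg Prod.snd h
  have h3 := dφ_τ c j hj
  have h4 := dφ_τ c j' hj'
  rw [← h2] at h4
  obtain ⟨K, hK⟩ := c.exists_dφ_equiv hj
  generalize (coord c j).2 = p at h3 h4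
  clear h h2
  obtain ⟨e, τ, hτ⟩ := j
  obtain ⟨e', τ', hτ'⟩ := j'
  obtain rfl : e = e' := hpt
  congr 1
  ext1 w
  apply K.injective
  rw [hK, hK]
  exact (h3 w).trans (h4 w).symm

theorem image_overlap (c c' : P.AdaptedChart) :
    coord c '' ({j : P.Jet1 | j.pt ∈ c.φ.source} ∩ {j : P.Jet1 | j.pt ∈ c'.φ.source}) =
      Prod.fst ⁻¹' c.overlap c' := by
  ext ⟨w, p⟩
  constructor
  · rintro ⟨j, ⟨hj, hj'⟩, h⟩
    have : c.φ j.pt = w := congrArg Prod.fst h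
    exact this ▸ c.mem_overlap c' hj hj'
  · intro h
    obtain ⟨e, he, he', rfl⟩ := c.exists_of_mem_overlap c' h
    obtain ⟨j, rfl, hj⟩ := exists_coord c he p
    exact ⟨j, ⟨he, he'⟩, hj⟩

/-- The change of jet coordinates. -/
noncomputable def change (c c' : P.AdaptedChart)
    (z : JetModel n k) :
    JetModel n k :=
  ((c'.φ ∘ c.φ.symm) z.1,
    (ContinuousLinearMap.snd ℝ (EuclideanSpace ℝ (Fin n)) (EuclideanSpace ℝ (Fin k))) ∘L
      (fderiv ℝ (c'.φ ∘ c.φ.symm) z.1) ∘L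
      (ContinuousLinearMap.inl ℝ (EuclideanSpace ℝ (Fin n)) (EuclideanSpace ℝ (Fin k)) +
        (ContinuousLinearMap.inr ℝ (EuclideanSpace ℝ (Fin n)) (EuclideanSpace ℝ (Fin k))) ∘L z.2) ∘L
      (fderiv ℝ (c.ψ ∘ c'.ψ.symm) ((c'.φ ∘ c.φ.symm) z.1).1))

theorem change_coord (c c' : P.AdaptedChart) (j : P.Jet1) (hj : j.pt ∈ c.φ.source)
    (hj' : j.pt ∈ c'.φ.source) : change c c' (coord c j) = coord c' j := by
  have h0 : (c'.φ ∘ c.φ.symm) (c.φ j.pt) = c'.φ j.pt := congrArg c'.φ (c.φ.left_inv hj)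
  refine Prod.ext h0 ?_
  ext1 v
  obtain ⟨L, hL⟩ := c'.exists_dψ_equiv (c'.proj_mem _ hj')
  obtain ⟨w, rfl⟩ := L.surjective v
  have h1 := congrArg Prod.snd (dφ_τ c' j hj' w)
  rw [hL]
  refine Eq.trans ?_ h1
  rw [c.dφ_change c' hj hj', dφ_τ c j hj, c'.dψ_change c (c'.proj_mem _ hj') (c.proj_mem _ hj)]
  have h2 : (coord c j).1 = c.φ j.pt := rfl
  simp only [change, ContinuousLinearMap.comp_apply, add_apply,
    ContinuousLinearMap.coe_snd', ContinuousLinearMap.inl_apply, ContinuousLinearMap.inr_apply,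
    h2, h0, c'.fst_eq _ hj']
  simp

theorem contDiffOn_change (c c' : P.AdaptedChart) :
    ContDiffOn ℝ ∞ (change c c') (Prod.fst ⁻¹' c.overlap c') := by
  have hmap : MapsTo (Prod.fst : JetModel n k → _)
      (Prod.fst ⁻¹' c.overlap c') (c.overlap c') := fun z hz => hz
  have h1 := (c.contDiffOn_change c').comp contDiff_fst.contDiffOn hmap
  have h2 := ((c.contDiffOn_change c').fderiv_of_isOpen (c.isOpen_overlap c')
    (m := ∞) (by simp)).comp contDiff_fst.contDiffOn hmap
  have h3 := ((c.contDiffOn_change_base c').fderiv_of_isOpen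
    (c'.ψ.symm.trans c.ψ).open_source (m := ∞) (by simp)).comp (contDiff_fst.comp_contDiffOn h1)
    fun z hz => c.fst_change_mem c' hz
  refine h1.prodMk ?_
  refine contDiffOn_const.clm_comp (h2.clm_comp (ContDiffOn.clm_comp ?_ h3))
  exact contDiffOn_const.add (contDiffOn_const.clm_comp contDiff_snd.contDiffOn)

variable [IsManifold 𝓘(ℝ, EuclideanSpace ℝ (Fin k)) ∞ F]
  [IsManifold 𝓘(ℝ, EuclideanSpace ℝ (Fin n)) ∞ M]

/-- The jet coordinates of all adapted charts. -/
noncomputable def coordinateSystem (P : SmoothFiberBundle n k F E M) :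
    CoordinateSystem P.Jet1 (JetModel n k) where
  ι := P.AdaptedChart
  coord := coord
  dom c := {j | j.pt ∈ c.φ.source}
  injOn := coord_injOn
  cover j := P.exists_adaptedChart j.pt
  isOpen_image c c' := by
    rw [image_overlap]
    exact (c.isOpen_overlap c').preimage continuous_fst
  smooth c c' := ⟨change c c', by rw [image_overlap]; exact contDiffOn_change c c',
    fun j hj => change_coord c c' j hj.1 hj.2⟩

noncomputable instance : TopologicalSpace P.Jet1 := (coordinateSystem P).topology

noncomputable instance : ChartedSpace (JetModel n k) P.Jet1 :=
  (coordinateSystem P).chartedSpace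

instance : IsManifold 𝓘(ℝ, JetModel n k) ∞ P.Jet1 :=
  (coordinateSystem P).isManifold

end Jet1

namespace AdaptedFrame

/-- The frame coordinates `(x^i, y^A, v^i_j, v^A_j, v^A_B)`. -/
noncomputable def coord (c : P.AdaptedChart) (u : P.AdaptedFrame) :
    FrameModel n k :=
  (c.φ u.pt, fun i => c.dφ u.pt (u.frame (Sum.inl i)),
    fun A => (c.dφ u.pt (u.frame (Sum.inr A))).2)

theorem dφ_inr (c : P.AdaptedChart) (u : P.AdaptedFrame) (hu : u.pt ∈ c.φ.source) (A : Fin k) :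
    c.dφ u.pt (u.frame (Sum.inr A)) = (0, (coord c u).2.2 A) := by
  refine Prod.ext ?_ rfl
  rw [c.fst_dφ hu, u.vertical]
  simp

theorem coord_injOn (c : P.AdaptedChart) :
    InjOn (coord c) {u : P.AdaptedFrame | u.pt ∈ c.φ.source} := by
  intro u hu u' hu' h
  have hpt : u.pt = u'.pt := c.φ.injOn hu hu' (congrArg Prod.fst h)
  have h1 := dφ_inr c u hu
  have h2 := dφ_inr c u' hu'
  rw [← h] at h2
  have h3 : ∀ i, c.dφ u.pt (u.frame (Sum.inl i)) = c.dφ u'.pt (u'.frame (Sum.inl i)) :=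
    fun i => congrFun (congrArg (fun z => z.2.1) h) i
  obtain ⟨K, hK⟩ := c.exists_dφ_equiv hu
  generalize (coord c u).2.2 = b at h1 h2
  clear h
  obtain ⟨e, f, hf⟩ := u
  obtain ⟨e', f', hf'⟩ := u'
  obtain rfl : e = e' := hpt
  congr 1
  refine Module.Basis.eq_of_apply_eq fun a => K.injective ?_
  rw [hK, hK]
  rcases a with i | A
  · exact h3 i
  · exact (h1 A).trans (h2 A).symm

/-- The coordinates `(v^i_j, v^A_j, v^A_B)` of frames: the block triangular matrix is invertible. -/
def frameDomain (n k : ℕ) : Set ((Fin n → EuclideanSpace ℝ (Fin n) × EuclideanSpace ℝ (Fin k)) ×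
    (Fin k → EuclideanSpace ℝ (Fin k))) :=
  {z | LinearIndependent ℝ (Sum.elim z.1
    (fun A => ((0 : EuclideanSpace ℝ (Fin n)), z.2 A)))}

theorem isOpen_frameDomain (n k : ℕ) : IsOpen (frameDomain n k) := by
  have h : Continuous fun z : (Fin n → EuclideanSpace ℝ (Fin n) × EuclideanSpace ℝ (Fin k)) ×
      (Fin k → EuclideanSpace ℝ (Fin k)) =>
      (Sum.elim z.1 (fun A => ((0 : EuclideanSpace ℝ (Fin n)), z.2 A))) := by
    refine continuous_pi fun a => ?_
    rcases a with i | A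
    · exact (continuous_apply i).comp continuous_fst
    · exact continuous_const.prodMk ((continuous_apply A).comp continuous_snd)
  exact (isOpen_setOfPred_linearIndependent (𝕜 := ℝ)).preimage h

/-- The frame over `e` with given coordinates `(v^i_j, v^A_j, v^A_B)`. -/
theorem exists_coord (c : P.AdaptedChart) {e : E} (he : e ∈ c.φ.source)
    {z : (Fin n → EuclideanSpace ℝ (Fin n) × EuclideanSpace ℝ (Fin k)) ×
      (Fin k → EuclideanSpace ℝ (Fin k))} (hz : z ∈ frameDomain n k) :
    ∃ u : P.AdaptedFrame, u.pt = e ∧ coord c u = (c.φ e, z) := by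
  obtain ⟨L, hL⟩ := c.exists_dψ_equiv (c.proj_mem _ he)
  obtain ⟨K, hK⟩ := c.exists_dφ_equiv he
  have hspan := LinearIndependent.span_eq_top_of_card_eq_finrank' hz (by simp)
  set b := Module.Basis.mk hz hspan.ge
  have hbi : ∀ i, b (Sum.inl i) = z.1 i := fun i => Module.Basis.mk_apply hz hspan.ge _
  have hbA : ∀ A, b (Sum.inr A) = (0, z.2 A) := fun A => Module.Basis.mk_apply hz hspan.ge _
  refine ⟨⟨e, b.map K.symm.toLinearEquiv, fun A => L.injective ?_⟩, rfl, ?_⟩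
  · rw [hL, ← c.fst_dφ he, ← hK]
    simp [hbA]
  · refine Prod.ext rfl (Prod.ext ?_ ?_)
    · funext i
      simp [coord, ← hK, hbi]
    · funext A
      simp [coord, ← hK, hbA]

theorem coord_mem_frameDomain (c : P.AdaptedChart) (u : P.AdaptedFrame)
    (hu : u.pt ∈ c.φ.source) : (coord c u).2 ∈ frameDomain n k := by
  obtain ⟨K, hK⟩ := c.exists_dφ_equiv hu
  have h := u.frame.linearIndependent.map' K.toLinearEquiv.toLinearMap
    (LinearMap.ker_eq_bot.2 K.injective)
  change LinearIndependent ℝ (Sum.elim _ _)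
  convert! h using 1
  funext a
  rcases a with i | A
  · exact (hK _).symm
  · exact (dφ_inr c u hu A).symm.trans (hK _).symm

theorem image_overlap (c c' : P.AdaptedChart) :
    coord c '' ({u : P.AdaptedFrame | u.pt ∈ c.φ.source} ∩
      {u : P.AdaptedFrame | u.pt ∈ c'.φ.source}) = c.overlap c' ×ˢ frameDomain n k := by
  ext ⟨w, z⟩
  constructor
  · rintro ⟨u, ⟨hu, hu'⟩, h⟩
    have h1 : c.φ u.pt = w := congrArg Prod.fst h
    have h2 := coord_mem_frameDomain c u hu
    rw [h] at h2
    exact ⟨h1 ▸ c.mem_overlap c' hu hu', h2⟩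
  · rintro ⟨h, h'⟩
    obtain ⟨e, he, he', h1⟩ := c.exists_of_mem_overlap c' h
    obtain ⟨u, rfl, hu⟩ := exists_coord c he h'
    exact ⟨u, ⟨he, he'⟩, by rw [hu, h1]⟩

/-- The change of frame coordinates. -/
noncomputable def change (c c' : P.AdaptedChart)
    (z : FrameModel n k) :
    FrameModel n k :=
  ((c'.φ ∘ c.φ.symm) z.1, fun i => fderiv ℝ (c'.φ ∘ c.φ.symm) z.1 (z.2.1 i),
    fun A => (fderiv ℝ (c'.φ ∘ c.φ.symm) z.1 (0, z.2.2 A)).2)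

theorem change_coord (c c' : P.AdaptedChart) (u : P.AdaptedFrame) (hu : u.pt ∈ c.φ.source)
    (hu' : u.pt ∈ c'.φ.source) : change c c' (coord c u) = coord c' u := by
  have h0 : (c'.φ ∘ c.φ.symm) (c.φ u.pt) = c'.φ u.pt := congrArg c'.φ (c.φ.left_inv hu)
  refine Prod.ext h0 (Prod.ext ?_ ?_)
  · funext i
    exact (c.dφ_change c' hu hu' _).symm
  · funext A
    change (fderiv ℝ (c'.φ ∘ c.φ.symm) (c.φ u.pt) (0, (coord c u).2.2 A)).2 = _
    rw [← dφ_inr c u hu, ← c.dφ_change c' hu hu']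
    rfl

theorem contDiffOn_change (c c' : P.AdaptedChart) :
    ContDiffOn ℝ ∞ (change c c') (c.overlap c' ×ˢ frameDomain n k) := by
  have hmap : MapsTo Prod.fst (c.overlap c' ×ˢ frameDomain n k) (c.overlap c') :=
    fun z hz => hz.1
  have h1 := (c.contDiffOn_change c').comp contDiff_fst.contDiffOn hmap
  have h2 := ((c.contDiffOn_change c').fderiv_of_isOpen (c.isOpen_overlap c')
    (m := ∞) (by simp)).comp contDiff_fst.contDiffOn hmap
  refine h1.prodMk (ContDiffOn.prodMk (contDiffOn_pi.2 fun i => ?_) (contDiffOn_pi.2 fun A => ?_))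
  · refine h2.clm_apply (ContDiff.contDiffOn ?_)
    exact (contDiff_apply ℝ _ i).comp (contDiff_fst.comp contDiff_snd)
  · refine contDiff_snd.comp_contDiffOn (h2.clm_apply (ContDiff.contDiffOn ?_))
    exact contDiff_const.prodMk ((contDiff_apply ℝ _ A).comp (contDiff_snd.comp contDiff_snd))

section Structure

variable [IsManifold 𝓘(ℝ, EuclideanSpace ℝ (Fin k)) ∞ F]
  [IsManifold 𝓘(ℝ, EuclideanSpace ℝ (Fin n)) ∞ M]

/-- The frame coordinates of all adapted charts. -/
noncomputable def coordinateSystem (P : SmoothFiberBundle n k F E M) :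
    CoordinateSystem P.AdaptedFrame (FrameModel n k) where
  ι := P.AdaptedChart
  coord := coord
  dom c := {u | u.pt ∈ c.φ.source}
  injOn := coord_injOn
  cover u := P.exists_adaptedChart u.pt
  isOpen_image c c' := by
    rw [image_overlap]
    exact (c.isOpen_overlap c').prod (isOpen_frameDomain n k)
  smooth c c' := ⟨change c c', by rw [image_overlap]; exact contDiffOn_change c c',
    fun u hu => change_coord c c' u hu.1 hu.2⟩

noncomputable instance : TopologicalSpace P.AdaptedFrame := (coordinateSystem P).topology

noncomputable instance : ChartedSpace (FrameModel n k) P.AdaptedFrame :=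
  (coordinateSystem P).chartedSpace

instance : IsManifold 𝓘(ℝ, FrameModel n k) ∞ P.AdaptedFrame :=
  (coordinateSystem P).isManifold

end Structure

end AdaptedFrame

/-! ### The structure group -/

/-- The group `G_V` of nonsingular block lower triangular matrices `(A 0; C B)`. -/
def structureGroup (n k : ℕ) : Subgroup (GL (Fin n ⊕ Fin k) ℝ) where
  carrier := {g | ∀ (i : Fin n) (A : Fin k), g.val (Sum.inl i) (Sum.inr A) = 0}
  one_mem' i A := by simp
  mul_mem' {g h} hg hh i A := by
    have hg' : ∀ (i : Fin n) (A : Fin k), g.val (Sum.inl i) (Sum.inr A) = 0 := hg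
    have hh' : ∀ (i : Fin n) (A : Fin k), h.val (Sum.inl i) (Sum.inr A) = 0 := hh
    change (g.val * h.val) (Sum.inl i) (Sum.inr A) = 0
    simp [Matrix.mul_apply, hg', hh']
  inv_mem' {g} hg i A := by
    have h : Matrix.BlockTriangular g.val
        (Sum.elim (fun _ => 1) (fun _ => 0) : Fin n ⊕ Fin k → ℕ) := by
      rintro (i | A) (j | B) hlt
      · simp at hlt
      · exact hg i B
      · simp at hlt
      · simp at hlt
    have := g.invertible
    have h' := Matrix.blockTriangular_inv_of_blockTriangular h
    change (g⁻¹).val (Sum.inl i) (Sum.inr A) = 0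
    rw [Matrix.coe_units_inv]
    exact h' (by simp)

/-- The matrix of an element of `G_V`. -/
def structureGroup.mat (g : structureGroup n k) : Matrix (Fin n ⊕ Fin k) (Fin n ⊕ Fin k) ℝ :=
  g.1.val

theorem structureGroup.mat_mul_inv (g : structureGroup n k) :
    structureGroup.mat g * structureGroup.mat g⁻¹ = 1 := Units.mul_inv g.1

theorem structureGroup.inv_mul_mat (g : structureGroup n k) :
    structureGroup.mat g⁻¹ * structureGroup.mat g = 1 := Units.inv_mul g.1

/-- The Lie algebra of `G_V`: all block lower triangular matrices. -/
def structureAlgebra (n k : ℕ) : Submodule ℝ (Matrix (Fin n ⊕ Fin k) (Fin n ⊕ Fin k) ℝ) where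
  carrier := {η | ∀ (i : Fin n) (A : Fin k), η (Sum.inl i) (Sum.inr A) = 0}
  zero_mem' i A := rfl
  add_mem' {η ζ} h h' i A := by simp [h i A, h' i A]
  smul_mem' c η h i A := by simp [h i A]

/-- The exponential map of `G_V`. -/
noncomputable def structureExp (η : structureAlgebra n k) : structureGroup n k :=
  ⟨(Matrix.isUnit_exp (η : Matrix (Fin n ⊕ Fin k) (Fin n ⊕ Fin k) ℝ)).unit, by
    have h : Matrix.BlockTriangular (η : Matrix (Fin n ⊕ Fin k) (Fin n ⊕ Fin k) ℝ)
        (Sum.elim (fun _ => 1) (fun _ => 0) : Fin n ⊕ Fin k → ℕ) := by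
      rintro (i | A) (j | B) hlt
      · simp at hlt
      · exact η.2 i B
      · simp at hlt
      · simp at hlt
    exact fun i A => h.exp (by simp)⟩

/-- The element `E^i_B` of the standard basis of matrices: its only nonzero entry, equal to `1`, is
in row `B` of the lower blocks and in column `i`. -/
def structureBasis (i : Fin n) (B : Fin k) : structureAlgebra n k :=
  ⟨Matrix.single (Sum.inr B) (Sum.inl i) 1, fun j A => by simp [Matrix.single]⟩

/-- The element `(I 0; ξ I)` of `G_V`. -/
def unipotent (ξ : Matrix (Fin k) (Fin n) ℝ) : structureGroup n k :=
  ⟨⟨Matrix.fromBlocks 1 0 ξ 1, Matrix.fromBlocks 1 0 (-ξ) 1,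
    by simp [Matrix.fromBlocks_multiply], by simp [Matrix.fromBlocks_multiply]⟩,
    fun i A => by simp⟩

/-- The action of `G_V` on `G_V / H`, `H = GL(n) × GL(k)`, where the coset of `(I 0; ξ I)` is
identified with the matrix `ξ`: `(A 0; C B) · ξ = C A⁻¹ + B ξ A⁻¹`. -/
noncomputable def affineAction (g : structureGroup n k) (ξ : Matrix (Fin k) (Fin n) ℝ) :
    Matrix (Fin k) (Fin n) ℝ :=
  (structureGroup.mat g).toBlocks₂₁ *
      (structureGroup.mat g).toBlocks₁₁⁻¹ +
    (structureGroup.mat g).toBlocks₂₂ * ξ *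
      (structureGroup.mat g).toBlocks₁₁⁻¹

theorem affineAction_mul (g : structureGroup n k) (ξ : Matrix (Fin k) (Fin n) ℝ) :
    affineAction g ξ * (structureGroup.mat g).toBlocks₁₁ =
      (structureGroup.mat g).toBlocks₂₁ +
        (structureGroup.mat g).toBlocks₂₂ * ξ := by
  have h0 : (structureGroup.mat g).toBlocks₁₂ = 0 := by
    ext i A; exact g.2 i A
  have h1 : IsUnit (structureGroup.mat g).det :=
    (Matrix.isUnit_iff_isUnit_det _).1 (Units.isUnit _)
  rw [← Matrix.fromBlocks_toBlocks (structureGroup.mat g), h0,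
    Matrix.det_fromBlocks_zero₁₂] at h1
  have h2 := isUnit_of_mul_isUnit_left h1
  rw [affineAction, Matrix.add_mul, Matrix.mul_assoc, Matrix.mul_assoc, Matrix.nonsing_inv_mul _ h2,
    Matrix.mul_one, Matrix.mul_one]

/-! ### Structures on the adapted frame bundle -/

namespace AdaptedFrame

/-- The right action of `G_V` on frames: `(u · g)_b = g^a_b u_a`. -/
noncomputable def act (u : P.AdaptedFrame) (g : structureGroup n k) : P.AdaptedFrame where
  pt := u.pt
  frame := u.frame.map (Matrix.toLinOfInv u.frame u.frame
    (M := structureGroup.mat g)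
    (M' := structureGroup.mat g⁻¹) (structureGroup.mat_mul_inv g) (structureGroup.inv_mul_mat g))
  vertical A := by
    have h : ∀ i : Fin n, structureGroup.mat g (Sum.inl i) (Sum.inr A) = 0 :=
      fun i => g.2 i A
    change P.dproj u.pt (Matrix.toLin u.frame u.frame (structureGroup.mat g)
      (u.frame (Sum.inr A))) = 0
    rw [Matrix.toLin_self, map_sum, Fintype.sum_sum_type]
    simp [u.vertical, h]

theorem act_frame (u : P.AdaptedFrame) (g : structureGroup n k) (b : Fin n ⊕ Fin k) :
    (u.act g).frame b =
      ∑ a, structureGroup.mat g a b • u.frame a := by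
  rw [← Matrix.toLin_self u.frame u.frame]
  rfl

variable [IsManifold 𝓘(ℝ, EuclideanSpace ℝ (Fin k)) ∞ F]
  [IsManifold 𝓘(ℝ, EuclideanSpace ℝ (Fin n)) ∞ M]

/-- The fundamental vertical vector field `η*` on `L_π E`, `η*(u) = d/dt (u · exp(tη))|_{t=0}`. -/
noncomputable def fundamentalField (η : structureAlgebra n k) (u : P.AdaptedFrame) :
    TangentSpace 𝓘(ℝ, FrameModel n k) u :=
  mfderiv 𝓘(ℝ, ℝ) 𝓘(ℝ, FrameModel n k) (fun t : ℝ => u.act (structureExp (t • η))) 0 (1 : ℝ)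

/-- The tangent map `λ_*(u) : T_u(L_π E) → T_e E` of the projection `λ`. -/
noncomputable def dpt (u : P.AdaptedFrame) :
    TangentSpace 𝓘(ℝ, FrameModel n k) u →L[ℝ] TSp (n + k) u.pt :=
  mfderiv 𝓘(ℝ, FrameModel n k) 𝓘(ℝ, EuclideanSpace ℝ (Fin (n + k))) AdaptedFrame.pt u

/-- The components `θ^i`, `θ^A` of the soldering form of `L_π E`. -/
noncomputable def soldering (a : Fin n ⊕ Fin k) (u : P.AdaptedFrame)
    (X : TangentSpace 𝓘(ℝ, FrameModel n k) u) : ℝ :=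
  u.frame.coord a (u.dpt X)

/-- The tensor field `E^{*i}_B ⊗ θ^B` (sum over `B`) on `L_π E`. -/
noncomputable def tangentTensor (i : Fin n) (u : P.AdaptedFrame)
    (X : TangentSpace 𝓘(ℝ, FrameModel n k) u) : TangentSpace 𝓘(ℝ, FrameModel n k) u :=
  ∑ B : Fin k, soldering (Sum.inr B) u X • fundamentalField (structureBasis i B) u

theorem span_baseFrame (u : P.AdaptedFrame) :
    ⊤ ≤ Submodule.span ℝ (range fun i : Fin n => P.dproj u.pt (u.frame (Sum.inl i))) := by
  intro w _
  obtain ⟨v, rfl⟩ := P.dproj_surjective u.pt w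
  rw [← u.frame.sum_repr v, map_sum, Fintype.sum_sum_type]
  simp only [map_smul, u.vertical, smul_zero, Finset.sum_const_zero, add_zero]
  exact Submodule.sum_mem _ fun i _ => Submodule.smul_mem _ _ (Submodule.subset_span ⟨i, rfl⟩)

/-- The basis `ê_i = π_*(e)(e_i)` of `T_{π(e)} M`. -/
noncomputable def baseFrame (u : P.AdaptedFrame) : Module.Basis (Fin n) ℝ (TSp n (P.proj u.pt)) :=
  Module.Basis.mk
    (linearIndependent_of_top_le_span_of_card_eq_finrank u.span_baseFrame
      ((Fintype.card_fin n).trans (finrank_euclideanSpace_fin (𝕜 := ℝ)).symm))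
    u.span_baseFrame

theorem baseFrame_apply (u : P.AdaptedFrame) (i : Fin n) :
    u.baseFrame i = P.dproj u.pt (u.frame (Sum.inl i)) :=
  Module.Basis.mk_apply _ _ _

/-- The linear map `T_{π(e)} M → T_e E` that takes `ê_i` to `e_i + ξ^A_i e_A`. -/
noncomputable def lift (u : P.AdaptedFrame) (ξ : Matrix (Fin k) (Fin n) ℝ) :
    TSp n (P.proj u.pt) →ₗ[ℝ] TSp (n + k) u.pt :=
  u.baseFrame.constr ℝ fun i => u.frame (Sum.inl i) + ∑ A, ξ A i • u.frame (Sum.inr A)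

theorem lift_apply (u : P.AdaptedFrame) (ξ : Matrix (Fin k) (Fin n) ℝ) (i : Fin n) :
    u.lift ξ (P.dproj u.pt (u.frame (Sum.inl i))) =
      u.frame (Sum.inl i) + ∑ A, ξ A i • u.frame (Sum.inr A) := by
  rw [← baseFrame_apply, lift, Module.Basis.constr_basis]

theorem continuous_lift (u : P.AdaptedFrame) (ξ : Matrix (Fin k) (Fin n) ℝ) :
    Continuous (u.lift ξ) := by
  have : FiniteDimensional ℝ (TSp n (P.proj u.pt)) :=
    inferInstanceAs (FiniteDimensional ℝ (EuclideanSpace ℝ (Fin n)))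
  have : T2Space (TSp n (P.proj u.pt)) := inferInstanceAs (T2Space (EuclideanSpace ℝ (Fin n)))
  exact LinearMap.continuous_of_finiteDimensional (u.lift ξ)

/-- The jet given by a frame `u = (e_i, e_A)_e` and a matrix `ξ`: the map `ê_i ↦ e_i + ξ^A_i e_A`. -/
noncomputable def jet (u : P.AdaptedFrame) (ξ : Matrix (Fin k) (Fin n) ℝ) : P.Jet1 where
  pt := u.pt
  τ := ⟨u.lift ξ, u.continuous_lift ξ⟩
  right_inv w := by
    have h : (P.dproj u.pt).toLinearMap ∘ₗ u.lift ξ = LinearMap.id := by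
      refine u.baseFrame.ext fun i => ?_
      rw [baseFrame_apply, LinearMap.comp_apply, lift_apply]
      simp [u.vertical]
    exact congrArg (fun f => f w) h

/-- The projection `ρ : L_π E → J¹π`: `ρ(e_i, e_A)_e` is the map `ê_i ↦ e_i`. -/
noncomputable def toJet (u : P.AdaptedFrame) : P.Jet1 := u.jet 0

theorem sum_aux {V : Type*} [AddCommGroup V] [Module ℝ V] (e : Fin n → V) (f : Fin k → V)
    (a : Fin n → ℝ) (c : Fin k → ℝ) (b : Fin k → Fin k → ℝ) (x : Fin k → ℝ)
    (ζ : Fin k → Fin n → ℝ) (h : ∀ A, ∑ i, ζ A i * a i = c A + ∑ B, b A B * x B) :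
    (∑ i, a i • e i + ∑ A, c A • f A) + ∑ B, x B • ∑ A, b A B • f A =
      ∑ i, a i • (e i + ∑ A, ζ A i • f A) := by
  simp only [smul_add, Finset.sum_add_distrib, Finset.smul_sum, smul_smul]
  rw [add_assoc, Finset.sum_comm (f := fun B A => (x B * b A B) • f A),
    Finset.sum_comm (f := fun i A => (a i * ζ A i) • f A), ← Finset.sum_add_distrib]
  congr 1
  refine Finset.sum_congr rfl fun A _ => ?_
  rw [← Finset.sum_smul, ← Finset.sum_smul, ← add_smul]
  congr 1
  rw [Finset.sum_congr rfl fun i _ => mul_comm (a i) (ζ A i), h A]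
  exact congrArg _ (Finset.sum_congr rfl fun B _ => mul_comm _ _)

theorem jet_act (u : P.AdaptedFrame) (g : structureGroup n k) (ξ : Matrix (Fin k) (Fin n) ℝ) :
    (u.act g).jet ξ = u.jet (affineAction g ξ) := by
  have h : (u.act g).lift ξ = u.lift (affineAction g ξ) := by
    refine (u.act g).baseFrame.ext fun j => ?_
    have hg := affineAction_mul g ξ
    have h12 : ∀ (i : Fin n) (A : Fin k),
        structureGroup.mat g (Sum.inl i) (Sum.inr A) = 0 := g.2
    generalize affineAction g ξ = ζ at hg
    have hg' : ∀ A, ∑ i, ζ A i * structureGroup.mat g (Sum.inl i) (Sum.inl j)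
        = structureGroup.mat g (Sum.inr A) (Sum.inl j) +
          ∑ B, structureGroup.mat g (Sum.inr A) (Sum.inr B) * ξ B j := by
      intro A
      have := congrFun (congrFun hg A) j
      simpa [Matrix.mul_apply, Matrix.toBlocks₁₁, Matrix.toBlocks₂₁, Matrix.toBlocks₂₂] using this
    have h1 : (u.act g).frame (Sum.inl j) =
        ∑ i, structureGroup.mat g (Sum.inl i) (Sum.inl j) • u.frame (Sum.inl i) +
          ∑ A, structureGroup.mat g (Sum.inr A) (Sum.inl j) • u.frame (Sum.inr A) :=
      (u.act_frame g _).trans (Fintype.sum_sum_type _)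
    have h2 : ∀ B, (u.act g).frame (Sum.inr B) =
        ∑ A, structureGroup.mat g (Sum.inr A) (Sum.inr B) • u.frame (Sum.inr A) := by
      intro B
      refine ((u.act_frame g _).trans (Fintype.sum_sum_type _)).trans ?_
      simp only [h12, zero_smul]
      exact (congrArg (· + _) Finset.sum_const_zero).trans (zero_add _)
    have h3 : P.dproj u.pt ((u.act g).frame (Sum.inl j)) =
        ∑ i, structureGroup.mat g (Sum.inl i) (Sum.inl j) •
            P.dproj u.pt (u.frame (Sum.inl i)) := by
      refine (congrArg (P.dproj u.pt) h1).trans ?_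
      simp [u.vertical]
    have h4 : u.lift ζ (P.dproj u.pt ((u.act g).frame (Sum.inl j))) =
        ∑ i, structureGroup.mat g (Sum.inl i) (Sum.inl j) •
          (u.frame (Sum.inl i) + ∑ A, ζ A i • u.frame (Sum.inr A)) := by
      refine (congrArg (u.lift ζ) h3).trans ?_
      simp [lift_apply]
    have h5 : ∑ B, ξ B j • (u.act g).frame (Sum.inr B) =
        ∑ B, ξ B j • ∑ A, structureGroup.mat g (Sum.inr A) (Sum.inr B) • u.frame (Sum.inr A) :=
      Finset.sum_congr rfl fun B _ => congrArg _ (h2 B)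
    rw [baseFrame_apply]
    refine ((u.act g).lift_apply ξ j).trans (Eq.trans ?_ h4.symm)
    refine (congrArg₂ (· + ·) h1 h5).trans ?_
    exact sum_aux _ _ _ _ (fun A B => structureGroup.mat g (Sum.inr A) (Sum.inr B))
      (fun B => ξ B j) ζ hg'
  have h' : (⟨(u.act g).lift ξ, (u.act g).continuous_lift ξ⟩ :
      TSp n (P.proj u.pt) →L[ℝ] TSp (n + k) u.pt) =
        ⟨u.lift (affineAction g ξ), u.continuous_lift _⟩ :=
    ContinuousLinearMap.coe_injective h
  change Jet1.mk u.pt ⟨(u.act g).lift ξ, (u.act g).continuous_lift ξ⟩ _ =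
    Jet1.mk u.pt ⟨u.lift (affineAction g ξ), u.continuous_lift _⟩ _
  congr 1

end AdaptedFrame

/-- The relation `(u · g, ξ) ∼ (u, g · ξ)`, `g ∈ G_V`, on `L_π E × (G_V / H)`. -/
def associatedRel (P : SmoothFiberBundle n k F E M)
    (p q : P.AdaptedFrame × Matrix (Fin k) (Fin n) ℝ) : Prop :=
  ∃ g : structureGroup n k, p.1 = q.1.act g ∧ affineAction g p.2 = q.2

/-- The associated bundle `L_π E ×_{G_V} (G_V / H)`. -/
def AssociatedBundle (P : SmoothFiberBundle n k F E M) : Type _ :=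
  Quot P.associatedRel

/-- The class `[u, ξ]`. -/
def jetClass (u : P.AdaptedFrame) (ξ : Matrix (Fin k) (Fin n) ℝ) : P.AssociatedBundle :=
  Quot.mk _ (u, ξ)

/-! ### Structures on the first jet bundle -/

/-- The vertical tangent space `V_e π`. -/
noncomputable def vertical (P : SmoothFiberBundle n k F E M) (e : E) :
    Submodule ℝ (TSp (n + k) e) :=
  LinearMap.ker (P.dproj e).toLinearMap

section Structures

variable [IsManifold 𝓘(ℝ, EuclideanSpace ℝ (Fin k)) ∞ F]
  [IsManifold 𝓘(ℝ, EuclideanSpace ℝ (Fin n)) ∞ M]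

/-- The identification of `L_π E ×_{G_V} (G_V / H)` with `J¹π`: the class `[(e_i, e_A)_e, ξ]` is the
map `ê_i ↦ e_i + ξ^A_i e_A`. -/
noncomputable def AssociatedBundle.toJet : P.AssociatedBundle → P.Jet1 :=
  Quot.lift (fun p => p.1.jet p.2) (by
    rintro ⟨v, ξ⟩ ⟨u, ζ⟩ ⟨g, h, h'⟩
    obtain rfl : v = u.act g := h
    obtain rfl : affineAction g ξ = ζ := h'
    exact u.jet_act g ξ)

namespace Jet1

/-- The tangent map `(π_{1,0})_*(j) : T_j(J¹π) → T_e E`. -/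
noncomputable def dpt (j : P.Jet1) :
    TangentSpace 𝓘(ℝ, JetModel n k) j →L[ℝ] TSp (n + k) j.pt :=
  mfderiv 𝓘(ℝ, JetModel n k) 𝓘(ℝ, EuclideanSpace ℝ (Fin (n + k))) Jet1.pt j

/-- The vertical differential `v ↦ v - (φ ∘ π)_* v` of a section `φ` with jet `j`; here
`φ_* = j.τ`. -/
noncomputable def verticalDifferential (j : P.Jet1) (v : TSp (n + k) j.pt) : P.vertical j.pt :=
  ⟨v - j.τ (P.dproj j.pt v), by
    change P.dproj j.pt (v - j.τ (P.dproj j.pt v)) = 0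
    rw [map_sub, j.right_inv, sub_self]⟩

/-- The canonical contact form `ω¹` on `J¹π`, with values in `Vπ`. -/
noncomputable def contactForm (j : P.Jet1) (X : TangentSpace 𝓘(ℝ, JetModel n k) j) :
    P.vertical j.pt :=
  j.verticalDifferential (j.dpt X)

/-- The jet `τ + t η ⊗ ζ`, for a covector `η` of `M` and a vertical vector `ζ`. -/
noncomputable def translate (j : P.Jet1) (η : TSp n (P.proj j.pt) →L[ℝ] ℝ) (ζ : P.vertical j.pt)
    (t : ℝ) : P.Jet1 where
  pt := j.pt
  τ := j.τ + t • η.smulRight (ζ : TSp (n + k) j.pt)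
  right_inv w := by
    have h : P.dproj j.pt (ζ : TSp (n + k) j.pt) = 0 := ζ.2
    simp [j.right_inv, h]

/-- The vertical lift `η ⊙_j ζ = d/dt (τ + t η ⊗ ζ)|_{t=0}`, with coordinates
`η_i ζ^A ∂/∂y^A_i`. -/
noncomputable def verticalLift (j : P.Jet1) (η : TSp n (P.proj j.pt) →L[ℝ] ℝ)
    (ζ : P.vertical j.pt) : TangentSpace 𝓘(ℝ, JetModel n k) j :=
  mfderiv 𝓘(ℝ, ℝ) 𝓘(ℝ, JetModel n k) (j.translate η ζ) 0 (1 : ℝ)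

/-- The vertical endomorphism `S_α` on `J¹π`, `S_α(j)(X) = α ⊙_j ω¹(X)`. -/
noncomputable def verticalEndomorphism (α : ∀ x : M, TSp n x →L[ℝ] ℝ) (j : P.Jet1)
    (X : TangentSpace 𝓘(ℝ, JetModel n k) j) : TangentSpace 𝓘(ℝ, JetModel n k) j :=
  j.verticalLift (α (P.proj j.pt)) (j.contactForm X)

end Jet1

namespace AdaptedFrame

/-- The tangent map `ρ_*(u)`. -/
noncomputable def dtoJet (u : P.AdaptedFrame) :
    TangentSpace 𝓘(ℝ, FrameModel n k) u →L[ℝ] TangentSpace 𝓘(ℝ, JetModel n k) u.toJet :=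
  mfderiv 𝓘(ℝ, FrameModel n k) 𝓘(ℝ, JetModel n k) AdaptedFrame.toJet u

/-- The pull-back `π^* α`. -/
noncomputable def pullback (P : SmoothFiberBundle n k F E M) (α : ∀ x : M, TSp n x →L[ℝ] ℝ) (e : E) :
    TSp (n + k) e →L[ℝ] ℝ :=
  (α (P.proj e)).comp (P.dproj e)

/-- The vector `ρ_*(u·ξ) ((π^*α)_e(e_i) (E^{*i}_B ⊗ θ^B)(u·ξ)(X))` at the point `ρ(u·ξ)`, where
`u = (e_i, e_A)_e` and `u·ξ = u (I 0; ξ I)`. -/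
noncomputable def pushedTensor (α : ∀ x : M, TSp n x →L[ℝ] ℝ) (u : P.AdaptedFrame)
    (ξ : Matrix (Fin k) (Fin n) ℝ)
    (X : TangentSpace 𝓘(ℝ, FrameModel n k) (u.act (unipotent ξ))) :
    TangentSpace 𝓘(ℝ, JetModel n k) (u.act (unipotent ξ)).toJet :=
  (u.act (unipotent ξ)).dtoJet
    (∑ i : Fin n, pullback P α u.pt (u.frame (Sum.inl i)) •
      tangentTensor i (u.act (unipotent ξ)) X)

end AdaptedFrame

end Structures

end SmoothFiberBundle

end Jets

open SmoothFiberBundle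

/-!
Since `E^i_B` squares to zero, `exp (t E^i_B) = 1 + t E^i_B`, so `ρ` carries the curve
`t ↦ u · exp (t E^i_B)` to the curve of jets `t ↦ τ + t ê^i ⊗ e_B`, where `τ = ρ(u)` and `ê^i` is
dual to `ê_i = π_* e_i`; hence `ρ_* E^{*i}_B = ê^i ⊙ e_B`. The lift `⊙` is bilinear,
`α = α(ê_i) ê^i`, and `ω¹(X) = θ^B(Y) e_B` when `X` and `Y` project onto the same vector of `E`.
So the pushed-forward tensor at `u · ξ` is `α ⊙ ω¹(X)`, which involves only the jet `ρ(u · ξ)` and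
that vector, not the representative.
-/

theorem hasMFDerivAt_of_chartAt {𝕜 H H' N N' : Type*} [NontriviallyNormedField 𝕜]
    [NormedAddCommGroup H] [NormedSpace 𝕜 H] [NormedAddCommGroup H'] [NormedSpace 𝕜 H']
    [TopologicalSpace N] [ChartedSpace H N] [TopologicalSpace N'] [ChartedSpace H' N']
    {f : N → N'} {x : N} {g : H → H'} {g' : H →L[𝕜] H'}
    (hg : HasFDerivAt g g' (chartAt H x x))
    (hsource : ∀ᶠ y in 𝓝 x, f y ∈ (chartAt H' (f x)).source)
    (hfg : ∀ᶠ y in 𝓝 x, chartAt H' (f x) (f y) = g (chartAt H x y)) :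
    HasMFDerivAt 𝓘(𝕜, H) 𝓘(𝕜, H') f x g' := by
  set φ := chartAt H x
  set φ' := chartAt H' (f x)
  have hx : x ∈ φ.source := mem_chart_source H x
  have hcont : ContinuousAt (φ'.symm ∘ g ∘ φ) x := by
    refine ContinuousAt.comp ?_ (hg.continuousAt.comp (φ.continuousAt hx))
    rw [comp_apply, ← hfg.self_of_nhds]
    exact φ'.continuousAt_symm (φ'.map_source hsource.self_of_nhds)
  refine ⟨hcont.congr ?_, ?_⟩
  · filter_upwards [hsource, hfg] with y hy hyg
    rw [comp_apply, comp_apply, ← hyg, φ'.left_inv hy]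
  · refine (hg.congr_of_eventuallyEq ?_).hasFDerivWithinAt
    filter_upwards [(φ.tendsto_symm hx).eventually hfg,
      φ.open_target.mem_nhds (φ.map_source hx)] with z hz hz'
    exact hz.trans (congrArg g (φ.right_inv hz'))

theorem hasMFDerivAt_of_chartAt_eq_add_smul {𝕜 H N : Type*} [NontriviallyNormedField 𝕜]
    [NormedAddCommGroup H] [NormedSpace 𝕜 H] [TopologicalSpace N] [ChartedSpace H N]
    {γ : 𝕜 → N} {t₀ : 𝕜} {w v : H} (hsource : ∀ᶠ t in 𝓝 t₀, γ t ∈ (chartAt H (γ t₀)).source)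
    (hγ : ∀ᶠ t in 𝓝 t₀, chartAt H (γ t₀) (γ t) = w + t • v) :
    HasMFDerivAt 𝓘(𝕜, 𝕜) 𝓘(𝕜, H) γ t₀ ((ContinuousLinearMap.id 𝕜 𝕜).smulRight v) :=
  hasMFDerivAt_of_chartAt (((hasFDerivAt_id t₀).smul_const v).const_add w) hsource hγ

theorem mfderiv_mfderiv_curve {𝕜 H H' N N' : Type*} [NontriviallyNormedField 𝕜]
    [NormedAddCommGroup H] [NormedSpace 𝕜 H] [NormedAddCommGroup H'] [NormedSpace 𝕜 H']
    [TopologicalSpace N] [ChartedSpace H N] [TopologicalSpace N'] [ChartedSpace H' N']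
    {γ : 𝕜 → N} {f : N → N'} {δ : 𝕜 → N'} {t₀ : 𝕜} {x : N} (hx : γ t₀ = x)
    (hγ : MDifferentiableAt 𝓘(𝕜, 𝕜) 𝓘(𝕜, H) γ t₀)
    (hf : MDifferentiableAt 𝓘(𝕜, H) 𝓘(𝕜, H') f x) (hδ : f ∘ γ = δ) (s : 𝕜) :
    (mfderiv 𝓘(𝕜, H) 𝓘(𝕜, H') f x (mfderiv 𝓘(𝕜, 𝕜) 𝓘(𝕜, H) γ t₀ s : H) : H') =
      (mfderiv 𝓘(𝕜, 𝕜) 𝓘(𝕜, H') δ t₀ s : H') := by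
  subst hδ
  exact (mfderiv_comp_apply_of_eq t₀ hf hγ hx s).symm

theorem exp_eq_sum_range_of_pow_eq_zero (𝕜 : Type*) {A : Type*} [Field 𝕜] [CharZero 𝕜] [Ring A]
    [Algebra 𝕜 A] [TopologicalSpace A] [IsTopologicalRing A] {a : A} {m : ℕ} (ha : a ^ m = 0) :
    NormedSpace.exp a = ∑ l ∈ Finset.range m, (l.factorial⁻¹ : 𝕜) • a ^ l := by
  rw [NormedSpace.exp_eq_tsum 𝕜]
  refine tsum_eq_sum fun l hl => ?_
  rw [pow_eq_zero_of_le (not_lt.1 (mt Finset.mem_range.2 hl)) ha, smul_zero]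

theorem sub_apply_eq_sum_coord_inr_smul {ι κ R V : Type*} [Finite ι] [Fintype κ] [Ring R]
    [AddCommGroup V] [Module R V] (b : Module.Basis (ι ⊕ κ) R V) (D : V →ₗ[R] V)
    (hι : ∀ i, D (b (Sum.inl i)) = b (Sum.inl i)) (hκ : ∀ A, D (b (Sum.inr A)) = 0) (v : V) :
    v - D v = ∑ A, b.repr v (Sum.inr A) • b (Sum.inr A) := by
  have := Fintype.ofFinite ι
  conv_lhs => rw [← b.sum_repr v, Fintype.sum_sum_type]
  simp [hι, hκ]

section MapOfGraph

variable {𝕜 ι V W : Type*} [NontriviallyNormedField 𝕜] [CompleteSpace 𝕜] [Finite ι]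
  [NormedAddCommGroup V] [NormedSpace 𝕜 V] [NormedAddCommGroup W] [NormedSpace 𝕜 W]

theorem differentiable_constrL (b : Module.Basis ι 𝕜 V) :
    Differentiable 𝕜 (b.constrL : (ι → W) → V →L[𝕜] W) := by
  have := Fintype.ofFinite ι
  have hsum : (b.constrL : (ι → W) → V →L[𝕜] W) = fun f =>
      ∑ i, ((ContinuousLinearMap.proj i).comp (b.equivFunL : V →L[𝕜] ι → 𝕜)).smulRight (f i) := by
    ext f v
    simp [Module.Basis.constrL_apply]
  rw [hsum]
  fun_prop

theorem isInvertible_constrL (b : Module.Basis ι 𝕜 V) (b' : Module.Basis ι 𝕜 W) :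
    (b.constrL b').IsInvertible := by
  have : FiniteDimensional 𝕜 V := b.finiteDimensional_of_finite
  exact ⟨(b.equiv b' (Equiv.refl ι)).toContinuousLinearEquiv, ContinuousLinearMap.coe_injective
    (b.ext fun i => (b.equiv_apply i b' _).trans (b.constrL_basis _ i).symm)⟩

/-- The linear map `V → W` whose graph is spanned by the vectors `v i`, provided that their first
components form a basis of `V`: in terms of an auxiliary basis `b`, the matrix of the second
components times the inverse of the matrix of the first ones. -/
noncomputable def mapOfGraph (b : Module.Basis ι 𝕜 V) (v : ι → V × W) : V →L[𝕜] W :=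
  b.constrL (fun i => (v i).2) ∘L (b.constrL fun i => (v i).1).inverse

variable {v : ι → V × W} (b : Module.Basis ι 𝕜 V) {b' : Module.Basis ι 𝕜 V}

theorem mapOfGraph_eq (hv : ∀ i, (v i).1 = b' i) {T : V →L[𝕜] W}
    (hT : ∀ i, T (v i).1 = (v i).2) : mapOfGraph b v = T := by
  have hinv : (b.constrL fun i => (v i).1).IsInvertible := by
    simpa only [hv] using isInvertible_constrL b b'
  have hcomp : b.constrL (fun i => (v i).2) = T ∘L b.constrL fun i => (v i).1 :=
    ContinuousLinearMap.coe_injective (b.ext fun i => by simp [hT])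
  rw [mapOfGraph, hcomp, ContinuousLinearMap.comp_assoc, hinv.self_comp_inverse,
    ContinuousLinearMap.comp_id]

theorem differentiableAt_mapOfGraph (hv : ∀ i, (v i).1 = b' i) :
    DifferentiableAt 𝕜 (mapOfGraph b : (ι → V × W) → V →L[𝕜] W) v := by
  have : FiniteDimensional 𝕜 V := b.finiteDimensional_of_finite
  have : CompleteSpace V := FiniteDimensional.complete 𝕜 V
  have := Fintype.ofFinite ι
  have hfst : Differentiable 𝕜 fun v : ι → V × W => fun i => (v i).1 := by fun_prop
  have hsnd : Differentiable 𝕜 fun v : ι → V × W => fun i => (v i).2 := by fun_prop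
  have hconstr_fst : Differentiable 𝕜 fun v : ι → V × W => b.constrL fun i => (v i).1 :=
    Differentiable.comp (g := b.constrL) (differentiable_constrL b) hfst
  have hconstr_snd : Differentiable 𝕜 fun v : ι → V × W => b.constrL fun i => (v i).2 :=
    Differentiable.comp (g := b.constrL) (differentiable_constrL b) hsnd
  have hinv : DifferentiableAt 𝕜 ContinuousLinearMap.inverse (b.constrL fun i => (v i).1) := by
    simp only [hv]
    exact ((isInvertible_constrL b b').contDiffAt_map_inverse (n := 1)).differentiableAt
      one_ne_zero
  exact (hconstr_snd v).clm_comp (DifferentiableAt.comp v (g := ContinuousLinearMap.inverse)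
    hinv (hconstr_fst v))

end MapOfGraph

namespace SmoothFiberBundle

variable {n k : ℕ} {F E M : Type*}
  [TopologicalSpace F] [ChartedSpace (EuclideanSpace ℝ (Fin k)) F]
  [TopologicalSpace E] [ChartedSpace (EuclideanSpace ℝ (Fin (n + k))) E]
  [TopologicalSpace M] [ChartedSpace (EuclideanSpace ℝ (Fin n)) M]
  {P : SmoothFiberBundle n k F E M}

theorem structureExp_smul_structureBasis (i : Fin n) (B : Fin k) (t : ℝ) :
    structureExp (t • structureBasis i B) = unipotent (t • Matrix.single B i 1) := by
  refine Subtype.ext (Units.ext ?_)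
  change NormedSpace.exp (t • Matrix.single (Sum.inr B) (Sum.inl i) (1 : ℝ)) =
    Matrix.fromBlocks 1 0 (t • Matrix.single B i 1) 1
  have hsq : (t • Matrix.single (Sum.inr B) (Sum.inl i) (1 : ℝ) :
      Matrix (Fin n ⊕ Fin k) (Fin n ⊕ Fin k) ℝ) ^ 2 = 0 := by
    simp [pow_two]
  rw [exp_eq_sum_range_of_pow_eq_zero ℝ hsq]
  ext (a | a) (b | b) <;> simp [Finset.sum_range_succ, Matrix.single, Matrix.one_apply]

theorem unipotent_zero : unipotent (0 : Matrix (Fin k) (Fin n) ℝ) = 1 :=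
  Subtype.ext (Units.ext Matrix.fromBlocks_one)

theorem affineAction_unipotent_zero (ξ : Matrix (Fin k) (Fin n) ℝ) :
    affineAction (unipotent ξ) 0 = ξ := by
  simp [affineAction, structureGroup.mat, unipotent]

namespace AdaptedFrame

theorem act_unipotent_frame_inl (u : P.AdaptedFrame) (ξ : Matrix (Fin k) (Fin n) ℝ) (i : Fin n) :
    (u.act (unipotent ξ)).frame (Sum.inl i) =
      u.frame (Sum.inl i) + ∑ A, ξ A i • u.frame (Sum.inr A) := by
  refine (u.act_frame _ _).trans ?_
  simp only [unipotent, structureGroup.mat, Fintype.sum_sum_type, Matrix.fromBlocks_apply₁₁,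
    Matrix.fromBlocks_apply₂₁, Matrix.one_apply, ite_smul, one_smul, zero_smul,
    Finset.sum_ite_eq', Finset.mem_univ, ↓reduceIte]
  rfl

theorem act_unipotent_frame_inr (u : P.AdaptedFrame) (ξ : Matrix (Fin k) (Fin n) ℝ) (A : Fin k) :
    (u.act (unipotent ξ)).frame (Sum.inr A) = u.frame (Sum.inr A) := by
  refine (u.act_frame _ _).trans ?_
  simp only [unipotent, structureGroup.mat, Fintype.sum_sum_type, Matrix.fromBlocks_apply₁₂,
    Matrix.fromBlocks_apply₂₂, Matrix.zero_apply, Matrix.one_apply, ite_smul, one_smul, zero_smul,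
    Finset.sum_const_zero, Finset.sum_ite_eq', Finset.mem_univ, ↓reduceIte, zero_add]
  rfl

theorem act_one (u : P.AdaptedFrame) : u.act 1 = u := by
  refine AdaptedFrame.ext rfl (Module.Basis.eq_of_apply_eq fun b => ?_)
  refine (u.act_frame _ _).trans ?_
  simp only [structureGroup.mat, OneMemClass.coe_one, Units.val_one, Matrix.one_apply, ite_smul,
    one_smul, zero_smul, Finset.sum_ite_eq', Finset.mem_univ, ↓reduceIte]
  rfl

theorem dproj_act_unipotent_frame_inl (u : P.AdaptedFrame) (ξ : Matrix (Fin k) (Fin n) ℝ)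
    (i : Fin n) :
    P.dproj u.pt ((u.act (unipotent ξ)).frame (Sum.inl i)) =
      P.dproj u.pt (u.frame (Sum.inl i)) := by
  refine (congrArg (P.dproj u.pt) (u.act_unipotent_frame_inl ξ i)).trans ?_
  simp [u.vertical]

theorem coord_act_unipotent_smul (c : P.AdaptedChart) (u : P.AdaptedFrame)
    (ζ : Matrix (Fin k) (Fin n) ℝ) (t : ℝ) :
    coord c (u.act (unipotent (t • ζ))) =
      coord c u + t • (0, fun i => c.dφ u.pt (∑ A, ζ A i • u.frame (Sum.inr A)), 0) := by
  refine Prod.ext (by simp [coord, act]) (Prod.ext (funext fun i => ?_) (funext fun A => ?_))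
  · refine (congrArg (c.dφ u.pt) (u.act_unipotent_frame_inl (t • ζ) i)).trans ?_
    simp [coord, Finset.smul_sum, smul_smul]
  · refine (congrArg (fun v => (c.dφ u.pt v).2) (u.act_unipotent_frame_inr (t • ζ) A)).trans ?_
    simp [coord]

end AdaptedFrame

namespace Jet1

/-- The linear part of the jet coordinates over `e`: the components `y^A_i` of a linear map
`T_{π(e)} M → T_e E`, whether or not it is a right inverse of `π_*(e)`. -/
noncomputable def coordLinear (c : P.AdaptedChart) (e : E) :
    (TSp n (P.proj e) →L[ℝ] TSp (n + k) e) →ₗ[ℝ]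
      (EuclideanSpace ℝ (Fin n) →L[ℝ] EuclideanSpace ℝ (Fin k)) where
  toFun σ := ContinuousLinearMap.snd ℝ (EuclideanSpace ℝ (Fin n)) (EuclideanSpace ℝ (Fin k)) ∘L
    c.dφ e ∘L σ ∘L (c.dψ (P.proj e)).inverse
  map_add' σ σ' := by ext1 v; simp
  map_smul' a σ := by ext1 v; simp

theorem coord_translate (c : P.AdaptedChart) (j : P.Jet1) (η : TSp n (P.proj j.pt) →L[ℝ] ℝ)
    (ζ : P.vertical j.pt) (t : ℝ) :
    coord c (j.translate η ζ t) =
      coord c j + t • (0, coordLinear c j.pt (η.smulRight (ζ : TSp (n + k) j.pt))) := by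
  refine Prod.ext (by simp [coord, translate]) ?_
  refine (map_add (coordLinear c j.pt) j.τ _).trans ?_
  rw [map_smul]
  rfl

end Jet1

section Smooth

variable [IsManifold 𝓘(ℝ, EuclideanSpace ℝ (Fin k)) ∞ F]
  [IsManifold 𝓘(ℝ, EuclideanSpace ℝ (Fin n)) ∞ M]

/-- The adapted chart around `e` that induces the preferred charts of `J¹π` and `L_π E` at the
points over `e`. -/
noncomputable def preferredChart (P : SmoothFiberBundle n k F E M) (e : E) : P.AdaptedChart :=
  (P.exists_adaptedChart e).choose

theorem mem_preferredChart_source (P : SmoothFiberBundle n k F E M) (e : E) :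
    e ∈ (P.preferredChart e).φ.source :=
  (P.exists_adaptedChart e).choose_spec

namespace Jet1

/-- The vertical lift `(η, ζ) ↦ η ⊙_j ζ` as a bilinear map, defined by its expression in the
preferred chart at `j`. -/
noncomputable def verticalLiftBilin (j : P.Jet1) :
    (TSp n (P.proj j.pt) →L[ℝ] ℝ) →ₗ[ℝ] P.vertical j.pt →ₗ[ℝ]
      TangentSpace 𝓘(ℝ, JetModel n k) j :=
  (LinearMap.mk₂ ℝ
    (fun (η : TSp n (P.proj j.pt) →L[ℝ] ℝ) (ζ : P.vertical j.pt) =>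
      η.smulRight (ζ : TSp (n + k) j.pt))
    (fun _ _ _ => by ext1; simp [add_smul])
    (fun _ _ _ => by ext1; simp [mul_smul])
    (fun _ _ _ => by ext1; simp)
    (fun _ _ _ => by ext1; simpa using smul_comm _ _ _)).compr₂
    (LinearMap.inr ℝ (EuclideanSpace ℝ (Fin n) × EuclideanSpace ℝ (Fin k)) _ ∘ₗ
      coordLinear (P.preferredChart j.pt) j.pt)

theorem verticalLiftBilin_apply (j : P.Jet1) (η : TSp n (P.proj j.pt) →L[ℝ] ℝ)
    (ζ : P.vertical j.pt) : j.verticalLiftBilin η ζ = j.verticalLift η ζ := by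
  have hderiv := hasMFDerivAt_of_chartAt_eq_add_smul (H := JetModel n k) (γ := j.translate η ζ)
    (t₀ := 0) (.of_forall fun _ => P.mem_preferredChart_source j.pt)
    (.of_forall (coord_translate (P.preferredChart j.pt) j η ζ))
  rw [verticalLift, hderiv.mfderiv]
  exact (one_smul ℝ _).symm

/-- The vector `α ⊙_j ω` for the vertical part `ω` of a tangent vector `v` of `E`: the value of
`S_α(j)` on the vectors `X` with `(π_{1,0})_* X = v`. -/
noncomputable def verticalEndomorphismOfDpt (α : ∀ x : M, TSp n x →L[ℝ] ℝ) (j : P.Jet1)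
    (v : TSp (n + k) j.pt) : TangentSpace 𝓘(ℝ, JetModel n k) j :=
  j.verticalLift (α (P.proj j.pt)) (j.verticalDifferential v)

theorem mk_verticalEndomorphismOfDpt_congr (α : ∀ x : M, TSp n x →L[ℝ] ℝ) {j j' : P.Jet1}
    (hj : j = j') {v : TSp (n + k) j.pt} {v' : TSp (n + k) j'.pt}
    (hv : (⟨j.pt, v⟩ : TangentBundle 𝓘(ℝ, EuclideanSpace ℝ (Fin (n + k))) E) = ⟨j'.pt, v'⟩) :
    (⟨j, j.verticalEndomorphismOfDpt α v⟩ : TangentBundle 𝓘(ℝ, JetModel n k) P.Jet1) =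
      ⟨j', j'.verticalEndomorphismOfDpt α v'⟩ := by
  subst hj
  obtain rfl : v = v' := eq_of_heq (Bundle.TotalSpace.mk.inj hv).2
  rfl

end Jet1

namespace AdaptedFrame

theorem toJet_act_unipotent (u : P.AdaptedFrame) (ξ : Matrix (Fin k) (Fin n) ℝ) :
    (u.act (unipotent ξ)).toJet = u.jet ξ := by
  rw [toJet, jet_act, affineAction_unipotent_zero]

theorem mdifferentiableAt_act_unipotent_smul (u : P.AdaptedFrame) (ζ : Matrix (Fin k) (Fin n) ℝ)
    (t : ℝ) :
    MDifferentiableAt 𝓘(ℝ, ℝ) 𝓘(ℝ, FrameModel n k)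
      (fun t : ℝ => u.act (unipotent (t • ζ))) t :=
  (hasMFDerivAt_of_chartAt_eq_add_smul (.of_forall fun _ => P.mem_preferredChart_source u.pt)
    (.of_forall (coord_act_unipotent_smul (P.preferredChart u.pt) u ζ))).mdifferentiableAt

theorem lift_zero_apply (u : P.AdaptedFrame) (i : Fin n) :
    u.lift 0 (P.dproj u.pt (u.frame (Sum.inl i))) = u.frame (Sum.inl i) :=
  (u.lift_apply 0 i).trans (by simp)

/-- The projection `ρ` in the coordinates of an adapted chart: the jet coordinates `y^A_i` are those
of the linear map `v^i_j ∂/∂x^i ↦ v^A_j ∂/∂y^A`. -/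
noncomputable def toJetCoord (z : FrameModel n k) : JetModel n k :=
  (z.1, mapOfGraph (EuclideanSpace.basisFun (Fin n) ℝ).toBasis z.2.1)

theorem exists_basis_eq_fst_coord {c : P.AdaptedChart} {u : P.AdaptedFrame}
    (hu : u.pt ∈ c.φ.source) : ∃ b : Module.Basis (Fin n) ℝ (EuclideanSpace ℝ (Fin n)),
      ∀ i, ((coord c u).2.1 i).1 = b i := by
  obtain ⟨L, hL⟩ := c.exists_dψ_equiv (c.proj_mem _ hu)
  refine ⟨u.baseFrame.map L.toLinearEquiv, fun i => (c.fst_dφ hu _).trans ?_⟩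
  rw [← hL, ← baseFrame_apply]
  rfl

theorem coord_toJet {c : P.AdaptedChart} {u : P.AdaptedFrame} (hu : u.pt ∈ c.φ.source) :
    Jet1.coord c u.toJet = toJetCoord (coord c u) := by
  obtain ⟨b, hb⟩ := exists_basis_eq_fst_coord hu
  refine Prod.ext rfl (mapOfGraph_eq _ hb fun i => ?_).symm
  have hgraph := (congrArg (c.dφ u.pt) (u.lift_zero_apply i)).symm.trans
    (Jet1.dφ_τ c u.toJet hu (P.dproj u.pt (u.frame (Sum.inl i))))
  exact (congrArg _ (congrArg Prod.fst hgraph)).trans (congrArg Prod.snd hgraph).symm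

theorem differentiableAt_toJetCoord {c : P.AdaptedChart} {u : P.AdaptedFrame}
    (hu : u.pt ∈ c.φ.source) : DifferentiableAt ℝ toJetCoord (coord c u) := by
  obtain ⟨b, hb⟩ := exists_basis_eq_fst_coord hu
  exact differentiableAt_fst.prodMk ((differentiableAt_mapOfGraph _ hb).comp (coord c u)
    (f := fun z : FrameModel n k => z.2.1) (by fun_prop))

theorem mdifferentiableAt_toJet (u : P.AdaptedFrame) :
    MDifferentiableAt 𝓘(ℝ, FrameModel n k) 𝓘(ℝ, JetModel n k)
      (AdaptedFrame.toJet (P := P)) u := by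
  have hsource : ∀ᶠ v : P.AdaptedFrame in 𝓝 u, v.pt ∈ (P.preferredChart u.pt).φ.source :=
    (chartAt (FrameModel n k) u).open_source.mem_nhds (mem_chart_source _ u)
  exact (hasMFDerivAt_of_chartAt
    (differentiableAt_toJetCoord (P.mem_preferredChart_source u.pt)).hasFDerivAt hsource
    (hsource.mono fun _ => coord_toJet)).mdifferentiableAt

/-- The vector `e_B` of the frame as an element of `V_e π`. -/
noncomputable def verticalFrame (u : P.AdaptedFrame) (B : Fin k) : P.vertical u.pt :=
  ⟨u.frame (Sum.inr B), u.vertical B⟩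

/-- The component `ê^i` of the basis of covectors dual to `ê_i = π_*(e)(e_i)`. -/
noncomputable def dualBaseFrame (u : P.AdaptedFrame) (i : Fin n) : TSp n (P.proj u.pt) →L[ℝ] ℝ :=
  have : FiniteDimensional ℝ (TSp n (P.proj u.pt)) :=
    inferInstanceAs (FiniteDimensional ℝ (EuclideanSpace ℝ (Fin n)))
  have : T2Space (TSp n (P.proj u.pt)) := inferInstanceAs (T2Space (EuclideanSpace ℝ (Fin n)))
  ⟨u.baseFrame.coord i, LinearMap.continuous_of_finiteDimensional _⟩

theorem dualBaseFrame_apply (u : P.AdaptedFrame) (i j : Fin n) :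
    u.dualBaseFrame i (P.dproj u.pt (u.frame (Sum.inl j))) = if j = i then 1 else 0 := by
  rw [← baseFrame_apply]
  exact (u.baseFrame.repr_self_apply j i)

theorem sum_smul_dualBaseFrame (u : P.AdaptedFrame) (η : TSp n (P.proj u.pt) →L[ℝ] ℝ) :
    ∑ i, η (P.dproj u.pt (u.frame (Sum.inl i))) • u.dualBaseFrame i = η := by
  refine ContinuousLinearMap.coe_injective (u.baseFrame.ext fun j => ?_)
  rw [baseFrame_apply]
  simp [dualBaseFrame_apply]

theorem jet_smul_single (u : P.AdaptedFrame) (i : Fin n) (B : Fin k) (t : ℝ) :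
    u.jet (t • Matrix.single B i 1) =
      u.toJet.translate (u.dualBaseFrame i) (u.verticalFrame B) t := by
  refine Jet1.ext rfl (ContinuousLinearMap.coe_injective (u.baseFrame.ext fun j => ?_))
  rw [baseFrame_apply]
  refine (u.lift_apply _ j).trans ?_
  refine Eq.trans ?_ (congrArg₂ (· + ·) (u.lift_zero_apply j).symm (congrArg
    (fun a => t • a • u.frame (Sum.inr B)) (u.dualBaseFrame_apply i j).symm))
  simp [Matrix.single, ite_and, eq_comm]

theorem dtoJet_fundamentalField_structureBasis (u : P.AdaptedFrame) (i : Fin n) (B : Fin k) :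
    u.dtoJet (fundamentalField (structureBasis i B) u) =
      u.toJet.verticalLift (u.dualBaseFrame i) (u.verticalFrame B) := by
  refine mfderiv_mfderiv_curve ?_ ?_ u.mdifferentiableAt_toJet ?_ 1
  · rw [structureExp_smul_structureBasis, zero_smul, unipotent_zero, act_one]
  · simp only [structureExp_smul_structureBasis]
    exact u.mdifferentiableAt_act_unipotent_smul (Matrix.single B i 1) 0
  · funext t
    rw [comp_apply, structureExp_smul_structureBasis, toJet_act_unipotent, jet_smul_single]

theorem verticalDifferential_toJet (u : P.AdaptedFrame) (v : TSp (n + k) u.pt) :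
    u.toJet.verticalDifferential v = ∑ B, u.frame.coord (Sum.inr B) v • u.verticalFrame B := by
  refine Subtype.ext ?_
  refine (sub_apply_eq_sum_coord_inr_smul u.frame (u.lift 0 ∘ₗ (P.dproj u.pt).toLinearMap)
    u.lift_zero_apply (fun A => ?_) v).trans ?_
  · exact (congrArg (u.lift 0) (u.vertical A)).trans (map_zero _)
  · simp [verticalFrame]

theorem dtoJet_sum_smul_tangentTensor (α : ∀ x : M, TSp n x →L[ℝ] ℝ) (u : P.AdaptedFrame)
    (X : TangentSpace 𝓘(ℝ, FrameModel n k) u) :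
    u.dtoJet (∑ i : Fin n, pullback P α u.pt (u.frame (Sum.inl i)) • tangentTensor i u X) =
      u.toJet.verticalEndomorphismOfDpt α (u.dpt X) := by
  set a : Fin n → ℝ := fun i => pullback P α u.pt (u.frame (Sum.inl i))
  let odot : (TSp n (P.proj u.pt) →L[ℝ] ℝ) →ₗ[ℝ] P.vertical u.pt →ₗ[ℝ]
      TangentSpace 𝓘(ℝ, JetModel n k) u.toJet := u.toJet.verticalLiftBilin
  have hfield (i : Fin n) (B : Fin k) : u.dtoJet (fundamentalField (structureBasis i B) u) =
      odot (u.dualBaseFrame i) (u.verticalFrame B) :=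
    (u.dtoJet_fundamentalField_structureBasis i B).trans (Jet1.verticalLiftBilin_apply _ _ _).symm
  calc u.dtoJet (∑ i, a i • tangentTensor i u X)
      = ∑ i, a i • ∑ B, soldering (Sum.inr B) u X •
          odot (u.dualBaseFrame i) (u.verticalFrame B) := by
        simp only [tangentTensor, map_sum, map_smul, hfield]
    _ = odot (∑ i, a i • u.dualBaseFrame i)
          (∑ B, soldering (Sum.inr B) u X • u.verticalFrame B) := by
        rw [map_sum odot, LinearMap.sum_apply]
        refine Finset.sum_congr rfl fun i _ => ?_
        rw [map_smul, LinearMap.smul_apply, map_sum]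
        simp only [map_smul]
    _ = odot (α (P.proj u.pt)) (u.toJet.verticalDifferential (u.dpt X)) :=
        congrArg₂ (fun η ζ => odot η ζ) (u.sum_smul_dualBaseFrame (α (P.proj u.pt)))
          (u.verticalDifferential_toJet (u.dpt X)).symm
    _ = u.toJet.verticalEndomorphismOfDpt α (u.dpt X) := Jet1.verticalLiftBilin_apply _ _ _

theorem pushedTensor_eq (α : ∀ x : M, TSp n x →L[ℝ] ℝ) (u : P.AdaptedFrame)
    (ξ : Matrix (Fin k) (Fin n) ℝ)
    (X : TangentSpace 𝓘(ℝ, FrameModel n k) (u.act (unipotent ξ))) :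
    u.pushedTensor α ξ X = (u.act (unipotent ξ)).toJet.verticalEndomorphismOfDpt α
      ((u.act (unipotent ξ)).dpt X) := by
  refine Eq.trans ?_ (dtoJet_sum_smul_tangentTensor α (u.act (unipotent ξ)) X)
  refine congrArg _ (Finset.sum_congr rfl fun i _ => congrArg (· • _) ?_)
  exact congrArg (α (P.proj u.pt)) (u.dproj_act_unipotent_frame_inl ξ i).symm

end AdaptedFrame

end Smooth

end SmoothFiberBundle

theorem mainTheorem5 {n k : ℕ} {F E M : Type*}
    [TopologicalSpace F] [ChartedSpace (EuclideanSpace ℝ (Fin k)) F]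
    [TopologicalSpace E] [ChartedSpace (EuclideanSpace ℝ (Fin (n + k))) E]
    [TopologicalSpace M] [ChartedSpace (EuclideanSpace ℝ (Fin n)) M]
    [IsManifold 𝓘(ℝ, EuclideanSpace ℝ (Fin k)) ∞ F]
    [IsManifold 𝓘(ℝ, EuclideanSpace ℝ (Fin (n + k))) ∞ E]
    [IsManifold 𝓘(ℝ, EuclideanSpace ℝ (Fin n)) ∞ M]
    (P : SmoothFiberBundle n k F E M) (α : ∀ x : M, TSp n x →L[ℝ] ℝ)
    (u : P.AdaptedFrame) (ξ : Matrix (Fin k) (Fin n) ℝ) :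
    (∀ (X : TangentSpace 𝓘(ℝ, JetModel n k) (jetClass u ξ).toJet)
      (X' : TangentSpace 𝓘(ℝ, FrameModel n k)
        (u.act (unipotent ξ))),
      Jet1.dpt _ X = AdaptedFrame.dpt _ X' →
      (⟨(jetClass u ξ).toJet,
          (jetClass u ξ).toJet.verticalEndomorphism α X⟩ :
          TangentBundle 𝓘(ℝ, JetModel n k) P.Jet1) =
        ⟨(u.act (unipotent ξ)).toJet, u.pushedTensor α ξ X'⟩) ∧
    (∀ (v : P.AdaptedFrame) (ζ : Matrix (Fin k) (Fin n) ℝ)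
      (X : TangentSpace 𝓘(ℝ, FrameModel n k)
        (u.act (unipotent ξ)))
      (Y : TangentSpace 𝓘(ℝ, FrameModel n k)
        (v.act (unipotent ζ))),
      jetClass u ξ = jetClass v ζ →
      (⟨u.pt, (u.act (unipotent ξ)).dpt X⟩ :
          TangentBundle 𝓘(ℝ, EuclideanSpace ℝ (Fin (n + k))) E) =
        ⟨v.pt, (v.act (unipotent ζ)).dpt Y⟩ →
      (⟨(u.act (unipotent ξ)).toJet, u.pushedTensor α ξ X⟩ :
          TangentBundle 𝓘(ℝ, JetModel n k) P.Jet1) =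
        ⟨(v.act (unipotent ζ)).toJet, v.pushedTensor α ζ Y⟩) := by
  have hj : (u.act (unipotent ξ)).toJet = (jetClass u ξ).toJet := u.toJet_act_unipotent ξ
  refine ⟨fun X X' h => ?_, fun v ζ X Y hjet h => ?_⟩
  · rw [AdaptedFrame.pushedTensor_eq]
    exact Jet1.mk_verticalEndomorphismOfDpt_congr α hj.symm
      (congrArg (Bundle.TotalSpace.mk u.pt) h)
  · have hj' : (v.act (unipotent ζ)).toJet = (jetClass v ζ).toJet := v.toJet_act_unipotent ζ
    rw [AdaptedFrame.pushedTensor_eq, AdaptedFrame.pushedTensor_eq]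
    exact Jet1.mk_verticalEndomorphismOfDpt_congr α
      (hj.trans ((congrArg AssociatedBundle.toJet hjet).trans hj'.symm)) h
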